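/- Let $p>1$ and $n>1$ be natural numbers, $\theta\in(-\pi,\pi]$ and $\gamma=e^{i\theta/2}$. All Hilbert spaces are finite-dimensional. A channel $\Phi:\mathfrak{B}(\mathcal H_A)\to\mathfrak{B}(\mathcal H_B)$ is a completely positive trace-preserving linear map. If $V:\mathcal H_A\to\mathcal H_B\otimes\mathcal H_E$ is an isometry with $\Phi(\rho)=\mathrm{Tr}_E V\rho V^*$, then $\mathcal G(\Phi)=\{V^*(I_B\otimes X)V : X\in\mathfrak{B}(\mathcal H_E)\}$ is the noncommutative graph of $\Phi$ (it does not depend on $V$). A subspace $\mathcal H_0\subseteq\mathcal H_A$ is an error correcting code for $\Phi$ if there is a channel $\Theta$ such that $\Theta(\Phi(\rho))=\rho$ for all states $\rho$ supported by $\mathcal H_0$. The 1-shot quantum zero-error capacity $\bar Q_0(\Phi)$ is the supremum of $\log_2\dim\mathcal H_0$ over all nonzero error correcting codes $\mathcal H_0$ for $\Phi$. Let $\mathfrak{A}_2=\left\{\begin{bmatrix}a&b\\b&a\end{bmatrix}: a,b\in\mathbb C\right\}$ and $\mathfrak{L}^p_0=\mathfrak{A}_2^{\otimes p}$, a maximal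 commutative $*$-subalgebra of the $2^p\times2^p$ matrices. Let $D(\theta)$ be the $2^p\times 2^p$ matrix made of $2^{p-1}\times2^{p-1}$ blocks $A_{ij}$ of size $2\times2$, where $$A_{ii}=\begin{bmatrix}1&1\\1&1\end{bmatrix},\qquad A_{ij}=\begin{bmatrix}\gamma&1\\1&\bar\gamma\end{bmatrix}\ (i<j),\qquad A_{ij}=\begin{bmatrix}\bar\gamma&1\\1&\gamma\end{bmatrix}\ (i>j),$$ and let $\mathfrak{L}^p_\theta$ be the image of $\mathfrak{L}^p_0$ under entrywise (Schur) multiplication by $D(\theta)$. Let $\Phi_\theta$ be an arbitrary channel with $\mathcal H_A=\mathbb C^{2^p}$ and $\mathcal G(\Phi_\theta)=\mathfrak{L}^p_\theta$, and let $$\delta_p=\frac1{2^{p-1}}\sum_{k=1}^{2^{p-1}}\left|\cot\left(\frac{(2k-1)\pi}{2^p}\right)\right|>0 .$$ (A) The equation $2(1-\cos(t/2))+\delta_p\sin(t/2)=n^{-1}\ln(3/2)$ has a least positive solution $\theta_n$, and $\bar Q_0(\Phi_\theta^{\otimes n})=0$ if $|\theta|\le\theta_n$. (B) If $\theta=\pm\pi/n$,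 then $\bar Q_0(\Phi_\theta^{\otimes n})\ge p-1$, and there exist $2^n$ mutually orthogonal $2^{p-1}$-dimensional error correcting codes for $\Phi_\theta^{\otimes n}$. For each binary $n$-tuple $(x_1,\dots,x_n)$ the corresponding code is spanned by the images of the vectors $$|\varphi_k\rangle=\tfrac1{\sqrt2}\bigl(|2k-1\,\ldots\,2k-1\rangle+i\,|2k\,\ldots\,2k\rangle\bigr),\qquad k=1,\dots,2^{p-1},$$ under the unitary $U_{x_1}\otimes\cdots\otimes U_{x_n}$, where $\{|k\rangle\}_{k=1}^{2^p}$ is the canonical basis of $\mathbb C^{2^p}$, $U_0=I_{2^p}$, and $U_1=W_{2^p}$ is the matrix with $1$ on the main skew-diagonal and $0$ elsewhere. -/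

import Mathlib

open scoped Kronecker ComplexOrder

namespace QuantumZeroError

noncomputable section

/-! ### Finite-dimensional quantum channels

The Hilbert space with canonical basis indexed by a finite type `a` is `EuclideanSpace ℂ a`, and
the operators on it are the matrices `Matrix a a ℂ`. -/

/-- The ampliation `Φ ⊗ id_k` of a linear map between matrix algebras. -/
def ampliation {a b : Type*} (Φ : Matrix a a ℂ →ₗ[ℂ] Matrix b b ℂ) (k : ℕ)
    (X : Matrix (a × Fin k) (a × Fin k) ℂ) : Matrix (b × Fin k) (b × Fin k) ℂ :=
  Matrix.of fun x y => Φ (Matrix.of fun u v => X (u, x.2) (v, y.2)) x.1 y.1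

/-- Complete positivity: every ampliation maps positive semidefinite matrices to positive
semidefinite matrices. -/
def IsCompletelyPositive {a b : Type*} (Φ : Matrix a a ℂ →ₗ[ℂ] Matrix b b ℂ) : Prop :=
  ∀ (k : ℕ) (X : Matrix (a × Fin k) (a × Fin k) ℂ), X.PosSemidef → (ampliation Φ k X).PosSemidef

/-- A quantum channel: a completely positive trace-preserving linear map. -/
structure IsChannel {a b : Type*} [Fintype a] [Fintype b]
    (Φ : Matrix a a ℂ →ₗ[ℂ] Matrix b b ℂ) : Prop where
  completelyPositive : IsCompletelyPositive Φ
  trace_preserving : ∀ X, (Φ X).trace = X.trace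

/-- The tensor product `M 0 ⊗ ⋯ ⊗ M (n-1)` of matrices, acting on the `n`-fold tensor product
space, whose canonical basis is indexed by `Fin n → a`. -/
def tensor {n : ℕ} {a b : Type*} (M : Fin n → Matrix a b ℂ) :
    Matrix (Fin n → a) (Fin n → b) ℂ :=
  Matrix.of fun x y => ∏ i, M i (x i) (y i)

/-- The tensor power `Φ^{⊗ n}`: the linear map sending `M 0 ⊗ ⋯ ⊗ M (n-1)` to
`Φ (M 0) ⊗ ⋯ ⊗ Φ (M (n-1))` (see `tensorPower_tensor`), given by its values on matrix units. -/
def tensorPower {a b : Type*} [Fintype a] [DecidableEq a] (n : ℕ)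
    (Φ : Matrix a a ℂ →ₗ[ℂ] Matrix b b ℂ) :
    Matrix (Fin n → a) (Fin n → a) ℂ →ₗ[ℂ] Matrix (Fin n → b) (Fin n → b) ℂ where
  toFun X := ∑ u, ∑ v, X u v • tensor fun i => Φ (Matrix.single (u i) (v i) 1)
  map_add' X Y := by simp only [Matrix.add_apply, add_smul, Finset.sum_add_distrib]
  map_smul' c X := by
    simp only [Matrix.smul_apply, smul_eq_mul, mul_smul, Finset.smul_sum, RingHom.id_apply]

theorem tensorPower_tensor {a b : Type*} [Fintype a] [DecidableEq a] (n : ℕ)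
    (Φ : Matrix a a ℂ →ₗ[ℂ] Matrix b b ℂ) (M : Fin n → Matrix a a ℂ) :
    tensorPower n Φ (tensor M) = tensor fun i => Φ (M i) := by
  ext x y
  have h : ∀ i, Φ (M i) (x i) (y i) =
      ∑ q : a × a, M i q.1 q.2 * Φ (Matrix.single q.1 q.2 1) (x i) (y i) := by
    intro i
    conv_lhs => rw [Matrix.matrix_eq_sum_single (M i)]
    rw [Fintype.sum_prod_type]
    simp only [map_sum, Matrix.sum_apply]
    refine Finset.sum_congr rfl fun u _ => Finset.sum_congr rfl fun v _ => ?_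
    have : Matrix.single u v (M i u v) = M i u v • Matrix.single u v (1 : ℂ) := by
      rw [Matrix.smul_single, smul_eq_mul, mul_one]
    rw [this, map_smul, Matrix.smul_apply, smul_eq_mul]
  simp only [tensorPower, tensor, LinearMap.coe_mk, AddHom.coe_mk, Matrix.of_apply,
    Matrix.sum_apply, Matrix.smul_apply, smul_eq_mul, h]
  rw [Finset.prod_univ_sum, Fintype.piFinset_univ, ← Fintype.sum_prod_type']
  symm
  refine Fintype.sum_equiv (Equiv.arrowProdEquivProdArrow (Fin n) (fun _ => a) (fun _ => a))
    _ _ fun q => ?_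
  simp [Equiv.arrowProdEquivProdArrow, Finset.prod_mul_distrib]

/-! ### Stinespring dilations, the complementary channel and the noncommutative graph -/

/-- `V : ℂ^a → ℂ^b ⊗ ℂ^d` is an isometry and `Φ ρ = Tr_E (V ρ V*)`, with environment `E = ℂ^d`. -/
def IsStinespring {a b : Type*} [Fintype a] [DecidableEq a] [Fintype b]
    (Φ : Matrix a a ℂ →ₗ[ℂ] Matrix b b ℂ) {d : ℕ} (V : Matrix (b × Fin d) a ℂ) : Prop :=
  V.conjTranspose * V = 1 ∧
    ∀ ρ, Φ ρ = Matrix.of fun x y => ∑ e, (V * ρ * V.conjTranspose) (x, e) (y, e)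

/-- The complementary channel `ρ ↦ Tr_B (V ρ V*)` attached to a Stinespring isometry. -/
def complementary {a b : Type*} [Fintype a] [Fintype b] {d : ℕ}
    (V : Matrix (b × Fin d) a ℂ) (ρ : Matrix a a ℂ) : Matrix (Fin d) (Fin d) ℂ :=
  Matrix.of fun e f => ∑ x, (V * ρ * V.conjTranspose) (x, e) (x, f)

/-- The dual `X ↦ V* (I_B ⊗ X) V` of the complementary channel (see `trace_complementary_mul`). -/
def complementaryDual {a b : Type*} [Fintype a] [Fintype b] [DecidableEq b] {d : ℕ}
    (V : Matrix (b × Fin d) a ℂ) (X : Matrix (Fin d) (Fin d) ℂ) : Matrix a a ℂ :=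
  V.conjTranspose * ((1 : Matrix b b ℂ) ⊗ₖ X) * V

theorem trace_complementary_mul {a b : Type*} [Fintype a] [Fintype b]
    [DecidableEq b] {d : ℕ} (V : Matrix (b × Fin d) a ℂ) (ρ : Matrix a a ℂ)
    (X : Matrix (Fin d) (Fin d) ℂ) :
    (complementary V ρ * X).trace = (ρ * complementaryDual V X).trace := by
  have h : (ρ * complementaryDual V X).trace =
      ((V * ρ * V.conjTranspose) * ((1 : Matrix b b ℂ) ⊗ₖ X)).trace := by
    unfold complementaryDual
    rw [← Matrix.mul_assoc, Matrix.trace_mul_comm]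
    simp only [Matrix.mul_assoc]
  rw [h]
  unfold complementary
  generalize V * ρ * V.conjTranspose = Y
  simp only [Matrix.trace, Matrix.diag, Matrix.mul_apply, Matrix.of_apply,
    Fintype.sum_prod_type, Matrix.kroneckerMap_apply, Matrix.one_apply, ite_mul, one_mul,
    zero_mul, mul_ite, mul_zero, Finset.sum_mul]
  have h' : ∀ (x : b) (e : Fin d),
      (∑ x', ∑ f, if x' = x then Y (x, e) (x', f) * X f e else 0) =
        ∑ f, Y (x, e) (x, f) * X f e := by
    intro x e
    rw [Finset.sum_comm]
    simp
  simp only [h']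
  rw [Finset.sum_comm]
  conv_lhs => rw [Finset.sum_comm]
  conv_rhs => rw [Finset.sum_comm]
  exact Finset.sum_congr rfl fun e _ => Finset.sum_comm

/-- The noncommutative graph of `Φ`: the image `Φ̂*(𝔅(H_E))` of the dual of the complementary
channel. All Stinespring isometries of `Φ` have the same image, because the complementary channel
is unique up to isometric equivalence. -/
def noncommutativeGraph {a b : Type*} [Fintype a] [DecidableEq a] [Fintype b] [DecidableEq b]
    (Φ : Matrix a a ℂ →ₗ[ℂ] Matrix b b ℂ) : Set (Matrix a a ℂ) :=
  {A | ∃ (d : ℕ) (V : Matrix (b × Fin d) a ℂ),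
    IsStinespring Φ V ∧ A ∈ Set.range (complementaryDual V)}

/-! ### Error correcting codes and the 1-shot quantum zero-error capacity -/

/-- `ρ` is a state (density matrix) supported by the subspace `H₀`. -/
def IsStateOn {a : Type*} [Fintype a] [DecidableEq a]
    (H₀ : Submodule ℂ (EuclideanSpace ℂ a)) (ρ : Matrix a a ℂ) : Prop :=
  ρ.PosSemidef ∧ ρ.trace = 1 ∧ LinearMap.range (Matrix.toEuclideanLin ρ) ≤ H₀

/-- `H₀` is an error correcting code for `Φ`: the channel `Φ` is perfectly reversible on it. -/
def IsErrorCorrectingCode {a b : Type*} [Fintype a] [DecidableEq a] [Fintype b]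
    (Φ : Matrix a a ℂ →ₗ[ℂ] Matrix b b ℂ) (H₀ : Submodule ℂ (EuclideanSpace ℂ a)) : Prop :=
  ∃ Θ : Matrix b b ℂ →ₗ[ℂ] Matrix a a ℂ, IsChannel Θ ∧ ∀ ρ, IsStateOn H₀ ρ → Θ (Φ ρ) = ρ

/-- The 1-shot quantum zero-error capacity: the supremum of `log₂ dim H₀` over the (nonzero) error
correcting codes `H₀`. -/
def oneShotCapacity {a b : Type*} [Fintype a] [DecidableEq a] [Fintype b]
    (Φ : Matrix a a ℂ →ₗ[ℂ] Matrix b b ℂ) : ℝ :=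
  sSup {r | ∃ H₀ : Submodule ℂ (EuclideanSpace ℂ a),
    H₀ ≠ ⊥ ∧ IsErrorCorrectingCode Φ H₀ ∧ r = Real.logb 2 (Module.finrank ℂ H₀)}

/-! ### The deformed algebra -/

/-- The algebra `𝔄₂` of the matrices with rows `(a, b)` and `(b, a)`. -/
def algA₂ : Set (Matrix (Fin 2) (Fin 2) ℂ) := {M | ∃ a b : ℂ, M = !![a, b; b, a]}

/-- The `l`-th binary digit of an index `i < 2 ^ p`, the most significant digit first, so that the
basis vector number `i` of `ℂ^(2^p) = (ℂ²)^{⊗ p}` is the tensor product of the basis vectors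
number `bit p i 0, …, bit p i (p-1)` of `ℂ²`. -/
def bit (p : ℕ) (i : Fin (2 ^ p)) (l : Fin p) : Fin 2 := finFunctionFinEquiv.symm i l.rev

/-- The algebra `𝔏₀^p = 𝔄₂^{⊗ p}` of `2 ^ p × 2 ^ p` matrices: the linear span of the products
`M₁ ⊗ ⋯ ⊗ M_p` with factors in `𝔄₂`. -/
def algL₀ (p : ℕ) : Submodule ℂ (Matrix (Fin (2 ^ p)) (Fin (2 ^ p)) ℂ) :=
  Submodule.span ℂ {A | ∃ M : Fin p → Matrix (Fin 2) (Fin 2) ℂ,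
    (∀ l, M l ∈ algA₂) ∧ A = (tensor M).submatrix (bit p) (bit p)}

/-- The matrix `D(θ)`, made of `2 × 2` blocks: all entries are `1` in the diagonal blocks; the rows
are `(γ, 1)`, `(1, γ̄)` in the blocks above and `(γ̄, 1)`, `(1, γ)` in the blocks below the diagonal,
where `γ = exp (i θ / 2)`. The row `i` (counted from `0`) is the row `i % 2` of the block row
`i / 2`. -/
def matD (p : ℕ) (θ : ℝ) : Matrix (Fin (2 ^ p)) (Fin (2 ^ p)) ℂ :=
  Matrix.of fun i j =>
    let γ : ℂ := Complex.exp (Complex.I * θ / 2)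
    if (i : ℕ) / 2 = (j : ℕ) / 2 then 1
    else if (i : ℕ) % 2 ≠ (j : ℕ) % 2 then 1
    else if (i : ℕ) / 2 < (j : ℕ) / 2 then
      if (i : ℕ) % 2 = 0 then γ else star γ
    else
      if (i : ℕ) % 2 = 0 then star γ else γ

/-- The deformation `𝔏_θ^p` of `𝔏₀^p`: its image under Schur multiplication by `D(θ)`. -/
def spaceL (p : ℕ) (θ : ℝ) : Set (Matrix (Fin (2 ^ p)) (Fin (2 ^ p)) ℂ) :=
  (fun A => (matD p θ).hadamard A) '' (algL₀ p : Set _)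

/-! ### The constant and the explicit codes -/

/-- `δ_p = 2^{-(p-1)} ∑_{k=1}^{2^{p-1}} |cot ((2k-1)π/2^p)|`. -/
def delta (p : ℕ) : ℝ :=
  1 / 2 ^ (p - 1) *
    ∑ k ∈ Finset.Icc (1 : ℕ) (2 ^ (p - 1)), |Real.cot ((2 * (k : ℝ) - 1) * Real.pi / 2 ^ p)|

/-- The matrix `W` with ones on the main skew-diagonal and zeros elsewhere. -/
def matW (p : ℕ) : Matrix (Fin (2 ^ p)) (Fin (2 ^ p)) ℂ :=
  Matrix.of fun i j => if i = j.rev then 1 else 0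

/-- `U_{x₁} ⊗ ⋯ ⊗ U_{x_n}`, where `U₀ = I` and `U₁ = W`. -/
def matU (p n : ℕ) (x : Fin n → Fin 2) :
    Matrix (Fin n → Fin (2 ^ p)) (Fin n → Fin (2 ^ p)) ℂ :=
  tensor fun i => if x i = 0 then 1 else matW p

/-- The product basis vector `|j … j⟩`, with the canonical basis counted from `j = 0`. -/
def ket (p n j : ℕ) : EuclideanSpace ℂ (Fin n → Fin (2 ^ p)) :=
  WithLp.toLp 2 fun y => if ∀ i, (y i : ℕ) = j then 1 else 0

/-- The vector `(|2k … 2k⟩ + i |2k+1 … 2k+1⟩) / √2`, `0 ≤ k < 2^{p-1}`, with the canonical basis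
counted from `0`; counted from `1` it is `(|2k-1 … 2k-1⟩ + i |2k … 2k⟩) / √2`, `1 ≤ k ≤ 2^{p-1}`. -/
def vecPhi (p n k : ℕ) : EuclideanSpace ℂ (Fin n → Fin (2 ^ p)) :=
  ((1 / Real.sqrt 2 : ℝ) : ℂ) • (ket p n (2 * k) + Complex.I • ket p n (2 * k + 1))

/-- The code attached to the binary `n`-tuple `x`: the span of the images of the `2^{p-1}` vectors
`vecPhi` under `U_{x₁} ⊗ ⋯ ⊗ U_{x_n}`. -/
def code (p n : ℕ) (x : Fin n → Fin 2) : Submodule ℂ (EuclideanSpace ℂ (Fin n → Fin (2 ^ p))) :=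
  Submodule.span ℂ
    (Set.range fun k : Fin (2 ^ (p - 1)) => Matrix.toEuclideanLin (matU p n x) (vecPhi p n k))

end

end QuantumZeroError

namespace QuantumZeroError

noncomputable section

set_option linter.unusedSectionVars false

/-! ### Tensor products of matrices -/

section Tensor

variable {n : ℕ} {a b c : Type*}

theorem tensor_apply (M : Fin n → Matrix a b ℂ) (x : Fin n → a) (y : Fin n → b) :
    tensor M x y = ∏ i, M i (x i) (y i) := rfl

theorem tensor_mul_tensor [Fintype b] (M : Fin n → Matrix a b ℂ) (N : Fin n → Matrix b c ℂ) :
    tensor M * tensor N = tensor fun i => M i * N i := by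
  ext x y
  simp only [Matrix.mul_apply, tensor_apply, Finset.prod_univ_sum, Fintype.piFinset_univ,
    Finset.prod_mul_distrib]

theorem tensor_conjTranspose (M : Fin n → Matrix a b ℂ) :
    (tensor M).conjTranspose = tensor fun i => (M i).conjTranspose := by
  ext x y
  simp [tensor_apply, Matrix.conjTranspose_apply]

theorem tensor_single [DecidableEq a] [DecidableEq b] (x : Fin n → a) (y : Fin n → b) :
    tensor (fun i => Matrix.single (x i) (y i) (1 : ℂ)) = Matrix.single x y 1 := by
  ext u v
  simp only [tensor_apply, Matrix.single_apply, Finset.prod_ite_zero, Finset.prod_const_one,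
    funext_iff, forall_and, Finset.mem_univ, true_imp_iff]

theorem tensor_one [DecidableEq a] : tensor (fun _ : Fin n => (1 : Matrix a a ℂ)) = 1 := by
  ext u v
  simp only [tensor_apply, Matrix.one_apply, Finset.prod_ite_zero, Finset.prod_const_one,
    funext_iff, Finset.mem_univ, true_imp_iff]

theorem tensor_sum {ι : Fin n → Type*} [∀ i, Fintype (ι i)]
    (N : ∀ i, ι i → Matrix a b ℂ) :
    tensor (fun i => ∑ e, N i e) = ∑ e : ∀ i, ι i, tensor fun i => N i (e i) := by
  ext x y
  simp only [tensor_apply, Matrix.sum_apply, Finset.prod_univ_sum, Fintype.piFinset_univ]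

theorem tensor_smul (c : Fin n → ℂ) (M : Fin n → Matrix a b ℂ) :
    tensor (fun i => c i • M i) = (∏ i, c i) • tensor M := by
  ext x y
  simp [tensor_apply, Finset.prod_mul_distrib]

end Tensor

/-! ### Operator-sum representations -/

section Kraus

variable {a b ι : Type*} [Fintype a] [Fintype b] [Fintype ι]

/-- The map `X ↦ ∑ e, K e * X * (K e)ᴴ` with Kraus operators `K e`. -/
def krausMap (K : ι → Matrix b a ℂ) : Matrix a a ℂ →ₗ[ℂ] Matrix b b ℂ where
  toFun X := ∑ e, K e * X * (K e).conjTranspose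
  map_add' X Y := by simp only [Matrix.mul_add, Matrix.add_mul, Finset.sum_add_distrib]
  map_smul' c X := by
    simp only [Matrix.mul_smul, Matrix.smul_mul, Finset.smul_sum, RingHom.id_apply]

theorem krausMap_apply (K : ι → Matrix b a ℂ) (X : Matrix a a ℂ) :
    krausMap K X = ∑ e, K e * X * (K e).conjTranspose := rfl

theorem isCompletelyPositive_krausMap (K : ι → Matrix b a ℂ) :
    IsCompletelyPositive (krausMap K) := by
  intro k X hX
  have h : ampliation (krausMap K) k X =
      ∑ e, (K e ⊗ₖ (1 : Matrix (Fin k) (Fin k) ℂ)) * X *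
        (K e ⊗ₖ (1 : Matrix (Fin k) (Fin k) ℂ)).conjTranspose := by
    ext x y
    simp only [ampliation, krausMap_apply, Matrix.of_apply, Matrix.sum_apply, Matrix.mul_apply,
      Matrix.conjTranspose_apply, Fintype.sum_prod_type, Matrix.kroneckerMap_apply,
      Matrix.one_apply]
    refine Finset.sum_congr rfl fun e _ => Finset.sum_congr rfl fun u _ => ?_
    simp [apply_ite]
  rw [h]
  exact Matrix.posSemidef_sum _ fun e _ => hX.mul_mul_conjTranspose_same _

theorem isChannel_krausMap [DecidableEq a] (K : ι → Matrix b a ℂ)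
    (hK : ∑ e, (K e).conjTranspose * K e = 1) : IsChannel (krausMap K) := by
  refine ⟨isCompletelyPositive_krausMap K, fun X => ?_⟩
  have h : ∀ e, (K e * X * (K e).conjTranspose).trace =
      ((K e).conjTranspose * K e * X).trace := fun e => by
    rw [Matrix.trace_mul_comm, Matrix.mul_assoc]
  simp only [krausMap_apply, Matrix.trace_sum, h]
  rw [← Matrix.trace_sum, ← Matrix.sum_mul, hK, Matrix.one_mul]

theorem tensorPower_eq_krausMap {n : ℕ} [DecidableEq a] {Φ : Matrix a a ℂ →ₗ[ℂ] Matrix b b ℂ}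
    {ι : Fin n → Type*} [∀ i, Fintype (ι i)] (K : ∀ i, ι i → Matrix b a ℂ)
    (hK : ∀ i, Φ = krausMap (K i)) :
    tensorPower n Φ = krausMap fun e : ∀ i, ι i => tensor fun i => K i (e i) := by
  refine Matrix.ext_linearMap _ fun u v => LinearMap.ext_ring ?_
  simp only [LinearMap.comp_apply, Matrix.singleLinearMap_apply]
  rw [← tensor_single, tensorPower_tensor]
  have h : ∀ i, Φ (Matrix.single (u i) (v i) 1) =
      ∑ e, K i e * Matrix.single (u i) (v i) (1 : ℂ) * (K i e).conjTranspose := fun i => by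
    rw [← krausMap_apply, ← hK i]
  simp only [h, tensor_sum, krausMap_apply, tensor_conjTranspose, tensor_mul_tensor]

/-- The Kraus operators of a Stinespring dilation. -/
def krausOf {d : ℕ} (V : Matrix (b × Fin d) a ℂ) (e : Fin d) : Matrix b a ℂ :=
  Matrix.of fun x u => V (x, e) u

theorem IsStinespring.eq_krausMap [DecidableEq a] {Φ : Matrix a a ℂ →ₗ[ℂ] Matrix b b ℂ} {d : ℕ}
    {V : Matrix (b × Fin d) a ℂ} (hV : IsStinespring Φ V) : Φ = krausMap (krausOf V) := by
  ext1 ρ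
  rw [hV.2]
  ext x y
  simp [krausMap_apply, krausOf, Matrix.sum_apply, Matrix.mul_apply]

theorem IsStinespring.sum_krausOf [DecidableEq a] {Φ : Matrix a a ℂ →ₗ[ℂ] Matrix b b ℂ} {d : ℕ}
    {V : Matrix (b × Fin d) a ℂ} (hV : IsStinespring Φ V) :
    ∑ e, (krausOf V e).conjTranspose * krausOf V e = 1 := by
  rw [← hV.1]
  ext x y
  simp only [krausOf, Matrix.sum_apply, Matrix.mul_apply, Fintype.sum_prod_type,
    Matrix.conjTranspose_apply, Matrix.of_apply]
  exact Finset.sum_comm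

theorem complementaryDual_eq_sum [DecidableEq b] {d : ℕ} (V : Matrix (b × Fin d) a ℂ)
    (X : Matrix (Fin d) (Fin d) ℂ) :
    complementaryDual V X =
      ∑ q : Fin d × Fin d, X q.1 q.2 • ((krausOf V q.1).conjTranspose * krausOf V q.2) := by
  ext x y
  have h : ∀ (z : b) (f : Fin d), (V.conjTranspose * ((1 : Matrix b b ℂ) ⊗ₖ X)) x (z, f) =
      ∑ e, star (V (z, e) x) * X e f := fun z f => by
    simp only [Matrix.mul_apply, Fintype.sum_prod_type, Matrix.conjTranspose_apply,
      Matrix.kroneckerMap_apply, Matrix.one_apply, ite_mul, one_mul, zero_mul, mul_ite, mul_zero]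
    rw [Finset.sum_comm]
    simp
  rw [complementaryDual, Matrix.mul_apply, Fintype.sum_prod_type]
  simp only [h, krausOf, Matrix.sum_apply, Matrix.mul_apply, Matrix.conjTranspose_apply,
    Matrix.of_apply, Matrix.smul_apply, smul_eq_mul, Finset.sum_mul, Finset.mul_sum,
    Fintype.sum_prod_type]
  rw [Finset.sum_comm]
  conv_rhs => rw [Finset.sum_comm]
  refine Finset.sum_congr rfl fun f _ => ?_
  rw [Finset.sum_comm]
  exact Finset.sum_congr rfl fun e _ => Finset.sum_congr rfl fun z _ => by ring

theorem conjTranspose_mul_mem_range_complementaryDual [DecidableEq b] {d : ℕ}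
    (V : Matrix (b × Fin d) a ℂ) (e f : Fin d) :
    (krausOf V e).conjTranspose * krausOf V f ∈ Set.range (complementaryDual V) := by
  refine ⟨Matrix.single e f 1, ?_⟩
  rw [complementaryDual_eq_sum, Finset.sum_eq_single (e, f)]
  · simp
  · intro q _ hq
    rw [Matrix.single_apply, if_neg, zero_smul]
    rintro ⟨rfl, rfl⟩
    exact hq rfl
  · simp

end Kraus

/-! ### Reversibility on a subspace -/

section KnillLaflamme

variable {a b : Type*} [Fintype a] [Fintype b] [DecidableEq a] [DecidableEq b]

theorem posSemidef_of_forall_nonneg (Q : Matrix a a ℂ)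
    (h : ∀ x : a → ℂ, 0 ≤ star x ⬝ᵥ Q.mulVec x) : Q.PosSemidef := by
  rw [← Matrix.isPositive_toEuclideanLin_iff, LinearMap.isPositive_iff_complex]
  intro x
  have h' : inner ℂ (Matrix.toEuclideanLin Q x) x = star (star x.ofLp ⬝ᵥ Q.mulVec x.ofLp) := by
    rw [EuclideanSpace.inner_eq_star_dotProduct, ← Matrix.star_dotProduct, dotProduct_comm]
    rfl
  have := h x.ofLp
  rw [Complex.nonneg_iff] at this
  rw [h']
  constructor
  · apply Complex.ext <;> simp [← this.2]
  · simpa using this.1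

open scoped MatrixOrder Matrix.Norms.L2Operator in
theorem trace_mul_nonneg {M R : Matrix a a ℂ} (hM : M.PosSemidef) (hR : R.PosSemidef) :
    0 ≤ (M * R).trace := by
  obtain ⟨C, rfl⟩ := CStarAlgebra.nonneg_iff_eq_star_mul_self.mp hR.nonneg
  rw [Matrix.star_eq_conjTranspose]
  rw [← Matrix.mul_assoc, Matrix.trace_mul_comm, ← Matrix.mul_assoc]
  exact (hM.mul_mul_conjTranspose_same C).trace_nonneg

theorem IsCompletelyPositive.posSemidef {Θ : Matrix b b ℂ →ₗ[ℂ] Matrix a a ℂ}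
    (hΘ : IsCompletelyPositive Θ) {X : Matrix b b ℂ} (hX : X.PosSemidef) : (Θ X).PosSemidef :=
  (hΘ 1 _ (hX.submatrix Prod.fst)).submatrix fun x => (x, 0)

/-- The dual `Θ*` of a linear map, with respect to the trace pairing. -/
def traceDual (Θ : Matrix b b ℂ →ₗ[ℂ] Matrix a a ℂ) (M : Matrix a a ℂ) : Matrix b b ℂ :=
  Matrix.of fun x y => (M * Θ (Matrix.single y x 1)).trace

theorem trace_traceDual_mul (Θ : Matrix b b ℂ →ₗ[ℂ] Matrix a a ℂ) (M : Matrix a a ℂ)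
    (X : Matrix b b ℂ) : (traceDual Θ M * X).trace = (M * Θ X).trace := by
  have h : X = ∑ y, ∑ x, X y x • Matrix.single y x (1 : ℂ) := by
    conv_lhs => rw [Matrix.matrix_eq_sum_single X]
    simp [Matrix.smul_single]
  conv_rhs => rw [h]
  simp only [map_sum, map_smul, Matrix.mul_sum, Matrix.trace_sum, Matrix.mul_smul,
    Matrix.trace_smul, smul_eq_mul]
  simp only [Matrix.trace, Matrix.diag, Matrix.mul_apply, traceDual, Matrix.of_apply]
  rw [Finset.sum_comm]
  exact Finset.sum_congr rfl fun y _ => Finset.sum_congr rfl fun x _ => mul_comm _ _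

theorem star_dotProduct_mulVec_eq_trace (Q : Matrix a a ℂ) (x y : a → ℂ) :
    star x ⬝ᵥ Q.mulVec y = (Q * Matrix.vecMulVec y (star x)).trace := by
  rw [Matrix.mul_vecMulVec, Matrix.trace_vecMulVec, dotProduct_comm]

theorem posSemidef_traceDual {Θ : Matrix b b ℂ →ₗ[ℂ] Matrix a a ℂ}
    (hΘ : IsCompletelyPositive Θ) {M : Matrix a a ℂ} (hM : M.PosSemidef) :
    (traceDual Θ M).PosSemidef := by
  refine posSemidef_of_forall_nonneg _ fun x => ?_
  rw [star_dotProduct_mulVec_eq_trace, trace_traceDual_mul]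
  exact trace_mul_nonneg hM (hΘ.posSemidef (Matrix.posSemidef_vecMulVec_self_star x))

theorem traceDual_one_sub {Θ : Matrix b b ℂ →ₗ[ℂ] Matrix a a ℂ} (hΘ : IsChannel Θ)
    (M : Matrix a a ℂ) : traceDual Θ (1 - M) = 1 - traceDual Θ M := by
  ext x y
  have h : (Matrix.single y x (1 : ℂ)).trace = (1 : Matrix b b ℂ) x y := by
    by_cases hxy : x = y
    · subst hxy
      simp
    · rw [Matrix.trace_single_eq_of_ne _ _ _ (Ne.symm hxy), Matrix.one_apply_ne hxy]
  simp [traceDual, Matrix.sub_mul, Matrix.trace_sub, hΘ.trace_preserving, h]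

theorem mulVec_eq_zero_of_trace_krausMap {ι : Type*} [Fintype ι] (K : ι → Matrix b a ℂ)
    {Q : Matrix b b ℂ} (hQ : Q.PosSemidef) (φ : a → ℂ)
    (h : (Q * krausMap K (Matrix.vecMulVec φ (star φ))).trace = 0) (e : ι) :
    Q.mulVec ((K e).mulVec φ) = 0 := by
  have h' : ∑ f, star ((K f).mulVec φ) ⬝ᵥ Q.mulVec ((K f).mulVec φ) = 0 := by
    rw [← h, krausMap_apply, Matrix.mul_sum, Matrix.trace_sum]
    refine Finset.sum_congr rfl fun f _ => ?_
    rw [star_dotProduct_mulVec_eq_trace, Matrix.mul_vecMulVec, Matrix.mul_vecMulVec,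
      Matrix.vecMulVec_mul, Matrix.mul_vecMulVec, Matrix.star_mulVec]
  rw [Finset.sum_eq_zero_iff_of_nonneg fun f _ => hQ.dotProduct_mulVec_nonneg _] at h'
  exact (hQ.dotProduct_mulVec_zero_iff _).mp (h' e (Finset.mem_univ e))

/-- If a channel reverses `krausMap K` on two orthogonal pure states, then the images of these
under the Kraus operators are orthogonal. -/
theorem dotProduct_eq_zero_of_recovery {ι : Type*} [Fintype ι] (K : ι → Matrix b a ℂ)
    {Θ : Matrix b b ℂ →ₗ[ℂ] Matrix a a ℂ} (hΘ : IsChannel Θ) {φ ψ : a → ℂ}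
    (hφ : star φ ⬝ᵥ φ = 1) (hφψ : star φ ⬝ᵥ ψ = 0)
    (h₁ : Θ (krausMap K (Matrix.vecMulVec φ (star φ))) = Matrix.vecMulVec φ (star φ))
    (h₂ : Θ (krausMap K (Matrix.vecMulVec ψ (star ψ))) = Matrix.vecMulVec ψ (star ψ)) (e f : ι) :
    star ((K e).mulVec φ) ⬝ᵥ (K f).mulVec ψ = 0 := by
  set P := Matrix.vecMulVec φ (star φ) with hP
  have hP1 : P.PosSemidef := Matrix.posSemidef_vecMulVec_self_star φ
  have hPP : P * P = P := by
    rw [hP, Matrix.vecMulVec_mul_vecMulVec, hφ, one_smul]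
  have hP2 : (1 - P).PosSemidef := by
    have : 1 - P = (1 - P).conjTranspose * (1 - P) := by
      rw [Matrix.conjTranspose_sub, Matrix.conjTranspose_one, hP1.isHermitian.eq, Matrix.mul_sub,
        Matrix.sub_mul, Matrix.sub_mul, hPP]
      simp
    rw [this]
    exact Matrix.posSemidef_conjTranspose_mul_self _
  have hQ1 := posSemidef_traceDual hΘ.completelyPositive hP1
  have hQ2 := posSemidef_traceDual hΘ.completelyPositive hP2
  have e1 : (traceDual Θ P).mulVec ((K f).mulVec ψ) = 0 := by
    refine mulVec_eq_zero_of_trace_krausMap K hQ1 ψ ?_ f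
    rw [trace_traceDual_mul, h₂, hP, Matrix.vecMulVec_mul_vecMulVec, hφψ]
    simp
  have e2 : (traceDual Θ (1 - P)).mulVec ((K e).mulVec φ) = 0 := by
    refine mulVec_eq_zero_of_trace_krausMap K hQ2 φ ?_ e
    rw [trace_traceDual_mul, h₁, Matrix.sub_mul, hPP]
    simp
  rw [traceDual_one_sub hΘ, Matrix.sub_mulVec, Matrix.one_mulVec, sub_eq_zero] at e2
  rw [e2, Matrix.star_mulVec, hQ1.isHermitian.eq, ← Matrix.dotProduct_mulVec, e1]
  simp

theorem isStateOn_vecMulVec {H₀ : Submodule ℂ (EuclideanSpace ℂ a)} {φ : a → ℂ}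
    (hφ : star φ ⬝ᵥ φ = 1) (hmem : WithLp.toLp 2 φ ∈ H₀) :
    IsStateOn H₀ (Matrix.vecMulVec φ (star φ)) := by
  refine ⟨Matrix.posSemidef_vecMulVec_self_star φ, ?_, ?_⟩
  · rw [Matrix.trace_vecMulVec, dotProduct_comm, hφ]
  · rintro _ ⟨x, rfl⟩
    have : Matrix.toEuclideanLin (Matrix.vecMulVec φ (star φ)) x =
        (star φ ⬝ᵥ x.ofLp) • WithLp.toLp 2 φ := by
      ext i
      simp [Matrix.toLpLin_apply, Matrix.vecMulVec_mulVec, mul_comm]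
    rw [this]
    exact H₀.smul_mem _ hmem

/-- The Knill–Laflamme condition is sufficient: here the code is spanned by the columns of the
isometry `M`. -/
theorem isErrorCorrectingCode_of_knillLaflamme [Nonempty a] {ι r : Type*} [Fintype ι]
    [DecidableEq ι] [Fintype r] [DecidableEq r] [Nonempty r] (K : ι → Matrix b a ℂ)
    (hK : ∑ e, (K e).conjTranspose * K e = 1)
    (M : Matrix a r ℂ) (hM : M.conjTranspose * M = 1) (c : ι → ι → ℂ)
    (hc : ∀ e f, M.conjTranspose * ((K e).conjTranspose * K f) * M = c e f • 1)
    (H₀ : Submodule ℂ (EuclideanSpace ℂ a))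
    (hH : ∀ v ∈ H₀, (M * M.conjTranspose).mulVec v.ofLp = v.ofLp) :
    IsErrorCorrectingCode (krausMap K) H₀ := by
  set L : ι → Matrix b r ℂ := fun e => K e * M with hL
  have hLL : ∀ e f, (L e).conjTranspose * L f = c e f • 1 := fun e f => by
    rw [← hc, hL]
    simp only [Matrix.conjTranspose_mul, Matrix.mul_assoc]
  obtain ⟨r₀⟩ := ‹Nonempty r›
  obtain ⟨a₀⟩ := ‹Nonempty a›
  set N : Matrix b ι ℂ := Matrix.of fun x e => L e x r₀ with hN
  have hcN : Matrix.of c = N.conjTranspose * N := by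
    ext e f
    have := congrFun (congrFun (hLL e f) r₀) r₀
    simp only [Matrix.smul_apply, Matrix.one_apply_eq, smul_eq_mul, mul_one] at this
    rw [Matrix.of_apply, ← this]
    simp [Matrix.mul_apply, hN]
  have hpos : (Matrix.of c).PosSemidef := hcN ▸ Matrix.posSemidef_conjTranspose_mul_self N
  set d := hpos.1.eigenvalues with hd
  have hd0 : ∀ k, 0 ≤ d k := hpos.eigenvalues_nonneg
  set U : Matrix ι ι ℂ := (hpos.1.eigenvectorUnitary : Matrix ι ι ℂ) with hU
  have hUU : U * U.conjTranspose = 1 := Unitary.coe_mul_star_self hpos.1.eigenvectorUnitary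
  have hUU' : U.conjTranspose * U = 1 := Unitary.coe_star_mul_self hpos.1.eigenvectorUnitary
  have hdiag : U.conjTranspose * Matrix.of c * U = Matrix.diagonal fun k => (d k : ℂ) := by
    have := hpos.1.spectral_theorem
    rw [Unitary.conjStarAlgAut_apply] at this
    rw [this]
    change U.conjTranspose * (U * _ * U.conjTranspose) * U = _
    rw [← Matrix.mul_assoc, ← Matrix.mul_assoc, hUU', Matrix.one_mul, Matrix.mul_assoc, hUU',
      Matrix.mul_one]
    rfl
  have htr : ∑ k, (d k : ℂ) = 1 := by
    have h1 : (Matrix.of c).trace = ∑ k, (d k : ℂ) := hpos.1.trace_eq_sum_eigenvalues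
    rw [← h1]
    have h2 : ∑ e, c e e • (1 : Matrix r r ℂ) = 1 := by
      simp only [← hc]
      rw [← Matrix.sum_mul, ← Matrix.mul_sum, hK, Matrix.mul_one, hM]
    have := congrFun (congrFun h2 r₀) r₀
    simpa [Matrix.sum_apply, Matrix.trace] using this
  set G : ι → Matrix b r ℂ := fun k => ∑ e, U e k • L e with hG
  have hGG : ∀ k l, (G k).conjTranspose * G l = (if k = l then (d k : ℂ) else 0) • 1 := by
    intro k l
    have h1 : (G k).conjTranspose * G l = (U.conjTranspose * Matrix.of c * U) k l • 1 := by
      have h2 : (U.conjTranspose * Matrix.of c * U) k l =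
          ∑ f, ∑ e, star (U e k) * c e f * U f l := by
        simp only [Matrix.mul_apply, Finset.sum_mul, Matrix.conjTranspose_apply, Matrix.of_apply]
      rw [h2]
      simp only [hG, Matrix.conjTranspose_sum, Matrix.conjTranspose_smul, Matrix.sum_mul,
        Matrix.mul_sum, Matrix.smul_mul, Matrix.mul_smul, hLL, Finset.sum_smul, Finset.smul_sum,
        smul_smul]
      refine Finset.sum_congr rfl fun f _ => Finset.sum_congr rfl fun e _ => ?_
      congr 1
      ring
    rw [h1, hdiag, Matrix.diagonal_apply]
  have hLG : ∀ e, L e = ∑ k, star (U e k) • G k := by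
    intro e
    simp only [hG, Finset.smul_sum, smul_smul]
    rw [Finset.sum_comm]
    have : ∀ f, ∑ k, (star (U e k) * U f k) • L f = (if f = e then (1 : ℂ) else 0) • L f := by
      intro f
      have h := congrFun (congrFun hUU f) e
      rw [Matrix.one_apply, Matrix.mul_apply] at h
      rw [← h, Finset.sum_smul]
      exact Finset.sum_congr rfl fun k _ => by rw [Matrix.conjTranspose_apply, mul_comm]
    simp only [this, ite_smul, one_smul, zero_smul, Finset.sum_ite_eq', Finset.mem_univ, if_true]
  have hG0 : ∀ k, d k = 0 → G k = 0 := by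
    intro k hk
    have := hGG k k
    rw [if_pos rfl, hk] at this
    simpa using this
  set s : ι → ℝ := fun k => (Real.sqrt (d k))⁻¹ with hs
  have hsd : ∀ k, (s k * s k * d k : ℂ) • G k = G k := by
    intro k
    by_cases hk : d k = 0
    · rw [hG0 k hk, smul_zero]
    · have : s k * s k * d k = 1 := by
        rw [hs]
        field_simp
        rw [Real.sq_sqrt (hd0 k), div_self hk]
      rw [← Complex.ofReal_mul, ← Complex.ofReal_mul, this, Complex.ofReal_one, one_smul]
  set P : Matrix b b ℂ := ∑ k, (s k * s k : ℂ) • (G k * (G k).conjTranspose) with hP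
  have hPG : ∀ l, P * G l = G l := by
    intro l
    rw [hP, Matrix.sum_mul]
    simp only [Matrix.smul_mul, Matrix.mul_assoc, hGG, Matrix.mul_smul, Matrix.mul_one, smul_smul]
    simp only [mul_ite, mul_zero, ite_smul, zero_smul, Finset.sum_ite_eq', Finset.mem_univ, if_true, hsd]
  have hPL : ∀ e, P * L e = L e := by
    intro e
    rw [hLG, Matrix.mul_sum]
    simp only [Matrix.mul_smul, hPG]
  have hPh : P.conjTranspose = P := by
    simp [hP, Matrix.conjTranspose_sum, Matrix.conjTranspose_smul, Matrix.conjTranspose_mul]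
  have hPP : P * P = P := by
    have : ∀ k, P * ((s k * s k : ℂ) • (G k * (G k).conjTranspose)) =
        (s k * s k : ℂ) • (G k * (G k).conjTranspose) := fun k => by
      rw [Matrix.mul_smul, ← Matrix.mul_assoc, hPG]
    nth_rewrite 2 [hP]
    rw [Matrix.mul_sum]
    simp only [this, ← hP]
  set R : ι ⊕ b → Matrix a b ℂ := Sum.elim
    (fun k => (s k : ℂ) • (M * (G k).conjTranspose))
    (fun x => Matrix.single a₀ x (1 : ℂ) * (1 - P)) with hR
  have hRR : ∑ k, (R k).conjTranspose * R k = 1 := by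
    rw [Fintype.sum_sum_type]
    have h1 : ∀ k, (R (Sum.inl k)).conjTranspose * R (Sum.inl k) =
        (s k * s k : ℂ) • (G k * (G k).conjTranspose) := by
      intro k
      simp only [hR, Sum.elim_inl, Matrix.conjTranspose_smul, Matrix.conjTranspose_mul,
        Matrix.conjTranspose_conjTranspose, Matrix.smul_mul, Matrix.mul_smul, smul_smul]
      rw [Matrix.mul_assoc, ← Matrix.mul_assoc M.conjTranspose, hM, Matrix.one_mul]
      simp
    have h2 : ∀ x, (R (Sum.inr x)).conjTranspose * R (Sum.inr x) =
        (1 - P) * Matrix.single x x (1 : ℂ) * (1 - P) := by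
      intro x
      simp only [hR, Sum.elim_inr, Matrix.conjTranspose_mul, Matrix.conjTranspose_sub, hPh,
        Matrix.conjTranspose_one, Matrix.conjTranspose_single, star_one]
      rw [Matrix.mul_assoc, ← Matrix.mul_assoc (Matrix.single x a₀ (1 : ℂ)),
        Matrix.single_mul_single_same, one_mul, Matrix.mul_assoc]
    have h3 : ∑ x : b, Matrix.single x x (1 : ℂ) = 1 := by
      ext x y
      simp only [Matrix.sum_apply, Matrix.single_apply, Matrix.one_apply]
      by_cases hxy : x = y
      · simp [hxy]
      · rw [if_neg hxy]
        exact Finset.sum_eq_zero fun z _ => if_neg fun h => hxy (h.1.symm.trans h.2)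
    simp only [h1, h2]
    rw [← Matrix.sum_mul, ← Matrix.mul_sum, h3, ← hP, Matrix.mul_one, Matrix.mul_sub,
      Matrix.sub_mul, Matrix.sub_mul, hPP]
    simp
  refine ⟨krausMap R, isChannel_krausMap R hRR, fun ρ hρ => ?_⟩
  have hMρ : M * M.conjTranspose * ρ = ρ := by
    ext i j
    have h := hH _ (hρ.2.2 ⟨WithLp.toLp 2 (Pi.single j 1), rfl⟩)
    simp only [Matrix.toLpLin_apply, Matrix.mulVec_single_one] at h
    exact congrFun h i
  have hρM : ρ * (M * M.conjTranspose) = ρ := by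
    have := congrArg Matrix.conjTranspose hMρ
    rwa [Matrix.conjTranspose_mul, hρ.1.isHermitian.eq, Matrix.conjTranspose_mul,
      Matrix.conjTranspose_conjTranspose] at this
  have hRL : ∀ k e, R (Sum.inl k) * L e = (s k * d k * star (U e k) : ℂ) • M := by
    intro k e
    simp only [hR, Sum.elim_inl]
    rw [hLG, Matrix.mul_sum]
    simp only [Matrix.smul_mul, Matrix.mul_smul, Matrix.mul_assoc, hGG, Matrix.mul_one, smul_smul]
    simp only [mul_ite, mul_zero, ite_smul, zero_smul, Finset.sum_ite_eq, Finset.mem_univ, if_true]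
    congr 1
    ring
  have hRL' : ∀ x e, R (Sum.inr x) * L e = 0 := by
    intro x e
    simp only [hR, Sum.elim_inr]
    rw [Matrix.mul_assoc, Matrix.sub_mul, hPL, Matrix.one_mul, sub_self, Matrix.mul_zero]
  set τ : Matrix r r ℂ := M.conjTranspose * ρ * M with hτ
  have hMτ : M * τ * M.conjTranspose = ρ := by
    rw [hτ]
    calc _ = (M * M.conjTranspose * ρ) * (M * M.conjTranspose) := by simp only [Matrix.mul_assoc]
      _ = ρ := by rw [hMρ, hρM]
  have hterm : ∀ k e, R k * (K e * ρ * (K e).conjTranspose) * (R k).conjTranspose =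
      (R k * L e) * τ * (R k * L e).conjTranspose := by
    intro k e
    conv_lhs => rw [← hMτ]
    simp only [hL, Matrix.conjTranspose_mul, Matrix.mul_assoc]
  rw [krausMap_apply, krausMap_apply, Fintype.sum_sum_type]
  simp only [Matrix.mul_sum, Matrix.sum_mul, hterm, hRL', Matrix.zero_mul, Finset.sum_const_zero,
    add_zero, hRL]
  have hsdd : ∀ k, s k * d k * (s k * d k) = d k := by
    intro k
    by_cases hk : d k = 0
    · simp [hk]
    · rw [hs]
      have : Real.sqrt (d k) ≠ 0 := (Real.sqrt_pos.mpr (lt_of_le_of_ne (hd0 k) (Ne.symm hk))).ne'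
      field_simp
      rw [Real.sq_sqrt (hd0 k)]
  have hfin : ∀ k, ∑ e, ((s k * d k * star (U e k) : ℂ) • M) * τ *
      ((s k * d k * star (U e k) : ℂ) • M).conjTranspose = (d k : ℂ) • ρ := by
    intro k
    have h : ∑ e, star (U e k) * U e k = 1 := by
      have h := congrFun (congrFun hUU' k) k
      rw [Matrix.one_apply_eq, Matrix.mul_apply] at h
      rw [← h]
      rfl
    have h' : ∀ e, ((s k * d k * star (U e k) : ℂ) • M) * τ *
      ((s k * d k * star (U e k) : ℂ) • M).conjTranspose =
        ((d k : ℂ) * (star (U e k) * U e k)) • ρ := by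
      intro e
      rw [Matrix.conjTranspose_smul, Matrix.smul_mul, Matrix.smul_mul, Matrix.mul_smul, smul_smul,
        hMτ]
      congr 1
      conv_rhs => rw [← hsdd k]
      simp
      ring
    simp only [h']
    rw [← Finset.sum_smul, ← Finset.mul_sum, h, mul_one]
  simp only [hfin]
  rw [← Finset.sum_smul, htr, one_smul]

end KnillLaflamme

/-! ### Norm bounds for Schur multipliers -/

section Schur

open scoped Matrix.Norms.L2Operator

variable {a : Type*} [Fintype a] [DecidableEq a]

/-- The Schur multiplication by `M` has operator norm at most `c`. -/
def IsSchurBound (M : a → a → ℂ) (c : ℝ) : Prop :=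
  ∀ A : Matrix a a ℂ, ‖(Matrix.of M).hadamard A‖ ≤ c * ‖A‖

theorem IsSchurBound.congr {M N : a → a → ℂ} {c d : ℝ} (h : IsSchurBound M c)
    (hMN : ∀ x y, N x y = M x y) (hcd : c = d) : IsSchurBound N d := by
  have : N = M := funext fun x => funext fun y => hMN x y
  rw [this, ← hcd]
  exact h

theorem isSchurBound_mul_of_norm_le_one {u w : a → ℂ} (hu : ∀ x, ‖u x‖ ≤ 1)
    (hw : ∀ x, ‖w x‖ ≤ 1) : IsSchurBound (fun x y => u x * w y) 1 := by
  intro A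
  have h : (Matrix.of fun x y => u x * w y).hadamard A =
      Matrix.diagonal u * A * Matrix.diagonal w := by
    ext x y
    simp only [Matrix.hadamard_apply, Matrix.of_apply, Matrix.mul_diagonal, Matrix.diagonal_mul]
    ring
  rw [h, one_mul]
  have hu' : ‖Matrix.diagonal u‖ ≤ 1 := by
    rw [Matrix.l2_opNorm_diagonal]
    exact (pi_norm_le_iff_of_nonneg zero_le_one).mpr hu
  have hw' : ‖Matrix.diagonal w‖ ≤ 1 := by
    rw [Matrix.l2_opNorm_diagonal]
    exact (pi_norm_le_iff_of_nonneg zero_le_one).mpr hw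
  calc _ ≤ ‖Matrix.diagonal u * A‖ * ‖Matrix.diagonal w‖ := Matrix.l2_opNorm_mul _ _
    _ ≤ ‖Matrix.diagonal u‖ * ‖A‖ * ‖Matrix.diagonal w‖ := by
      gcongr
      exact Matrix.l2_opNorm_mul _ _
    _ ≤ 1 * ‖A‖ * 1 := by gcongr
    _ = ‖A‖ := by ring

theorem isSchurBound_one : IsSchurBound (fun _ _ : a => 1) 1 := by
  refine (isSchurBound_mul_of_norm_le_one (u := fun _ => 1) (w := fun _ => 1) ?_ ?_).congr
    (fun x y => ?_) rfl <;> simp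

theorem IsSchurBound.smul {M : a → a → ℂ} {c : ℝ} (h : IsSchurBound M c) (z : ℂ) :
    IsSchurBound (fun x y => z * M x y) (‖z‖ * c) := by
  intro A
  have : (Matrix.of fun x y => z * M x y).hadamard A = z • (Matrix.of M).hadamard A := by
    ext x y
    simp [mul_assoc]
  rw [this, norm_smul, mul_assoc]
  exact mul_le_mul_of_nonneg_left (h A) (norm_nonneg z)

theorem IsSchurBound.add {M N : a → a → ℂ} {c d : ℝ} (hM : IsSchurBound M c)
    (hN : IsSchurBound N d) : IsSchurBound (fun x y => M x y + N x y) (c + d) := by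
  intro A
  have : (Matrix.of fun x y => M x y + N x y).hadamard A =
      (Matrix.of M).hadamard A + (Matrix.of N).hadamard A := by
    ext x y
    simp [add_mul]
  rw [this, add_mul]
  exact (norm_add_le _ _).trans (add_le_add (hM A) (hN A))

theorem IsSchurBound.mul {M N : a → a → ℂ} {c d : ℝ} (hM : IsSchurBound M c)
    (hN : IsSchurBound N d) (hc : 0 ≤ c) : IsSchurBound (fun x y => M x y * N x y) (c * d) := by
  intro A
  have : (Matrix.of fun x y => M x y * N x y).hadamard A =
      (Matrix.of M).hadamard ((Matrix.of N).hadamard A) := by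
    ext x y
    simp [mul_assoc]
  rw [this, mul_assoc]
  exact (hM _).trans (mul_le_mul_of_nonneg_left (hN A) hc)

theorem isSchurBound_sum {ι : Type*} (s : Finset ι) {M : ι → a → a → ℂ} {c : ι → ℝ}
    (h : ∀ i ∈ s, IsSchurBound (M i) (c i)) :
    IsSchurBound (fun x y => ∑ i ∈ s, M i x y) (∑ i ∈ s, c i) := by
  classical
  induction s using Finset.induction_on with
  | empty =>
    intro A
    have : (Matrix.of fun x y => ∑ i ∈ (∅ : Finset ι), M i x y).hadamard A = 0 := by
      ext x y
      simp
    rw [this]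
    simp
  | insert i s hi ih =>
    refine ((h i (Finset.mem_insert_self i s)).add
      (ih fun j hj => h j (Finset.mem_insert_of_mem hj))).congr (fun x y => ?_) ?_ <;>
    rw [Finset.sum_insert hi]

theorem isSchurBound_prod {ι : Type*} (s : Finset ι) {M : ι → a → a → ℂ} {c : ι → ℝ}
    (h : ∀ i ∈ s, IsSchurBound (M i) (c i)) (hc : ∀ i ∈ s, 0 ≤ c i) :
    IsSchurBound (fun x y => ∏ i ∈ s, M i x y) (∏ i ∈ s, c i) := by
  classical
  induction s using Finset.induction_on with
  | empty => exact isSchurBound_one.congr (fun x y => by simp) (by simp)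
  | insert i s hi ih =>
    refine ((h i (Finset.mem_insert_self i s)).mul
      (ih (fun j hj => h j (Finset.mem_insert_of_mem hj))
        fun j hj => hc j (Finset.mem_insert_of_mem hj))
      (hc i (Finset.mem_insert_self i s))).congr (fun x y => ?_) ?_ <;>
    rw [Finset.prod_insert hi]

theorem isSchurBound_eq_fin_two (g : a → Fin 2) :
    IsSchurBound (fun x y => if g x = g y then 1 else 0) 1 := by
  have h1 := (isSchurBound_mul_of_norm_le_one (u := fun x => (-1) ^ (g x : ℕ))
    (w := fun x => (-1) ^ (g x : ℕ)) (fun x => by simp) (fun x => by simp)).smul (1 / 2)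
  have h2 := (isSchurBound_one (a := a)).smul (1 / 2)
  refine (h1.add h2).congr (fun x y => ?_) (by norm_num)
  generalize g x = i
  generalize g y = j
  fin_cases i <;> fin_cases j <;> norm_num

theorem isSchurBound_eq {ι : Type*} [Fintype ι] (g : a → ι → Fin 2) :
    IsSchurBound (fun x y => if g x = g y then 1 else 0) 1 := by
  refine (isSchurBound_prod Finset.univ
    (fun i _ => isSchurBound_eq_fin_two fun x => g x i) fun _ _ => zero_le_one).congr
    (fun x y => ?_) (by simp)
  simp only [Finset.prod_ite_zero, Finset.prod_const_one, funext_iff, Finset.mem_univ,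
    true_imp_iff]

theorem pow_eq_neg_one_of_isPrimitiveRoot {N : ℕ} (hN : 0 < N) {ζ : ℂ}
    (hζ : IsPrimitiveRoot ζ (2 * N)) : ζ ^ N = -1 :=
  (hζ.pow (by omega) (mul_comm 2 N)).eq_neg_one_of_two_right

/-- The sums of powers of the roots of `z ^ N = -1`. -/
theorem sum_zpow_skew_roots {N : ℕ} (hN : 0 < N) {ζ : ℂ} (hζ : IsPrimitiveRoot ζ (2 * N)) (j : ℤ)
    (h1 : -(2 * N : ℤ) < j) (h2 : j < N) :
    ∑ m ∈ Finset.range N, (ζ ^ (2 * m + 1)) ^ j =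
      if j = 0 then (N : ℂ) else if j = -N then -N else 0 := by
  have hζ0 : ζ ≠ 0 := hζ.ne_zero (by omega)
  have hζN : ζ ^ N = -1 := pow_eq_neg_one_of_isPrimitiveRoot hN hζ
  split_ifs with hj hj'
  · simp [hj]
  · have h : ∀ m, (ζ ^ (2 * m + 1)) ^ j = -1 := by
      intro m
      rw [hj', zpow_neg, zpow_natCast, ← pow_mul, mul_comm, pow_mul, hζN, pow_succ, pow_mul]
      norm_num
    simp [h]
  · have h : ∀ m, (ζ ^ (2 * m + 1)) ^ j = ζ ^ j * (ζ ^ (2 * j)) ^ m := by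
      intro m
      rw [← zpow_natCast, ← zpow_natCast, ← zpow_mul, ← zpow_mul, ← zpow_add₀ hζ0]
      congr 1
      push_cast
      ring
    have hne : ζ ^ (2 * j) ≠ 1 := by
      rw [Ne, hζ.zpow_eq_one_iff_dvd]
      rintro ⟨q, hq⟩
      push_cast at hq
      have hq' : j = N * q := by linarith
      have hN' : (0 : ℤ) < N := by exact_mod_cast hN
      have : q < 1 := by nlinarith
      have : -2 < q := by nlinarith
      obtain rfl | rfl : q = 0 ∨ q = -1 := by omega
      · exact hj (by simpa using hq')
      · exact hj' (by simpa using hq')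
    have hpow : (ζ ^ (2 * j)) ^ N = 1 := by
      rw [← zpow_natCast, ← zpow_mul, hζ.zpow_eq_one_iff_dvd]
      exact ⟨j, by push_cast; ring⟩
    simp only [h, ← Finset.mul_sum]
    rw [geom_sum_eq hne, hpow]
    simp

theorem sum_sum_zpow_skew_roots {N : ℕ} (hN : 0 < N) {ζ : ℂ} (hζ : IsPrimitiveRoot ζ (2 * N))
    {k l : ℕ} (hk : k < N) (hl : l < N) :
    ∑ m ∈ Finset.range N, (∑ e ∈ Finset.range (N - 1), (ζ ^ (2 * m + 1)) ^ (-(e + 1 : ℤ))) *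
        ((ζ ^ (2 * m + 1)) ^ (-(k : ℤ)) * (ζ ^ (2 * m + 1)) ^ (l : ℤ)) =
      if k < l then (N : ℂ) else if l < k then -N else 0 := by
  have hζ0 : ζ ≠ 0 := hζ.ne_zero (by omega)
  simp only [Finset.sum_mul]
  rw [Finset.sum_comm]
  have h : ∀ e ∈ Finset.range (N - 1), ∑ m ∈ Finset.range N, (ζ ^ (2 * m + 1)) ^ (-(e + 1 : ℤ)) *
        ((ζ ^ (2 * m + 1)) ^ (-(k : ℤ)) * (ζ ^ (2 * m + 1)) ^ (l : ℤ)) =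
      (if e = l - k - 1 then if k < l then (N : ℂ) else 0 else 0) +
        if e = N + l - k - 1 then if l < k then -(N : ℂ) else 0 else 0 := by
    intro e he
    rw [Finset.mem_range] at he
    have h' : ∀ m, (ζ ^ (2 * m + 1)) ^ (-(e + 1 : ℤ)) *
        ((ζ ^ (2 * m + 1)) ^ (-(k : ℤ)) * (ζ ^ (2 * m + 1)) ^ (l : ℤ)) =
        (ζ ^ (2 * m + 1)) ^ ((l : ℤ) - k - (e + 1)) := by
      intro m
      rw [← zpow_add₀ (pow_ne_zero _ hζ0), ← zpow_add₀ (pow_ne_zero _ hζ0)]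
      congr 1
      ring
    simp only [h']
    rw [sum_zpow_skew_roots hN hζ _ (by omega) (by omega)]
    split_ifs <;> first | omega | simp
  rw [Finset.sum_congr rfl h, Finset.sum_add_distrib, Finset.sum_ite_eq', Finset.sum_ite_eq']
  simp only [Finset.mem_range]
  split_ifs <;> first | omega | simp

theorem norm_sum_zpow_eq_abs_cot {N : ℕ} (hN : 0 < N) (m : ℕ) {ω : ℂ}
    (hω : ω = Complex.exp (2 * Complex.I * ((2 * m + 1) * Real.pi / (2 * N) : ℝ)))
    (hωN : ω ^ N = -1) :
    ‖∑ e ∈ Finset.range (N - 1), ω ^ (-(e + 1 : ℤ))‖ =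
      |Real.cot ((2 * m + 1) * Real.pi / (2 * N))| := by
  have hω0 : ω ≠ 0 := by
    rintro rfl
    rw [zero_pow hN.ne'] at hωN
    norm_num at hωN
  have hω1 : ω ≠ 1 := by
    rintro rfl
    norm_num at hωN
  have hq1 : ω⁻¹ ≠ 1 := by simpa using hω1
  have h1 : ∑ e ∈ Finset.range (N - 1), ω ^ (-(e + 1 : ℤ)) = -2 / (ω⁻¹ - 1) - 1 := by
    have hterm : ∀ e : ℕ, ω ^ (-(e + 1 : ℤ)) = ω⁻¹ ^ (e + 1) := by
      intro e
      rw [zpow_neg, inv_pow]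
      norm_cast
    have h2 := geom_sum_eq hq1 N
    obtain ⟨N', rfl⟩ : ∃ N', N = N' + 1 := ⟨N - 1, by omega⟩
    rw [Finset.sum_range_succ', pow_zero, inv_pow _ (N' + 1), hωN] at h2
    simp only [hterm, Nat.add_sub_cancel]
    rw [eq_sub_of_add_eq h2]
    norm_num
  have h3 : -2 / (ω⁻¹ - 1) - 1 = -Complex.I * Complex.cot ((2 * m + 1) * Real.pi / (2 * N) : ℝ) := by
    rw [Complex.cot_eq_exp_ratio, ← hω]
    have : 1 - ω ≠ 0 := sub_ne_zero.mpr (Ne.symm hω1)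
    have hI := Complex.I_ne_zero
    have : ω⁻¹ - 1 = (1 - ω) / ω := by field_simp
    rw [this]
    field_simp
    ring
  rw [h1, h3, norm_mul, norm_neg, Complex.norm_I, one_mul, ← Complex.ofReal_cot,
    Complex.norm_real, Real.norm_eq_abs]

theorem isSchurBound_sign {N : ℕ} (hN : 0 < N) (g : a → ℕ) (hg : ∀ x, g x < N) :
    IsSchurBound (fun x y => if g x < g y then 1 else if g y < g x then -1 else 0)
      (1 / N * ∑ m ∈ Finset.range N, |Real.cot ((2 * m + 1) * Real.pi / (2 * N))|) := by
  set ζ : ℂ := Complex.exp (2 * Real.pi * Complex.I / (2 * N : ℕ)) with hζdef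
  have hζ : IsPrimitiveRoot ζ (2 * N) := Complex.isPrimitiveRoot_exp _ (by omega)
  have hnorm : ‖ζ‖ = 1 := hζ.norm'_eq_one (by omega)
  have hN' : (N : ℂ) ≠ 0 := by exact_mod_cast hN.ne'
  have hωN : ∀ m : ℕ, (ζ ^ (2 * m + 1)) ^ N = -1 := by
    intro m
    rw [← pow_mul, mul_comm, pow_mul, pow_eq_neg_one_of_isPrimitiveRoot hN hζ, pow_succ, pow_mul]
    norm_num
  have hω : ∀ m : ℕ, ζ ^ (2 * m + 1) =
      Complex.exp (2 * Complex.I * ((2 * m + 1) * Real.pi / (2 * N) : ℝ)) := by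
    intro m
    rw [hζdef, ← Complex.exp_nat_mul]
    congr 1
    push_cast
    ring
  have h := (isSchurBound_sum (Finset.range N) fun m _ =>
    (isSchurBound_mul_of_norm_le_one (u := fun x => (ζ ^ (2 * m + 1)) ^ (-(g x : ℤ)))
      (w := fun x => (ζ ^ (2 * m + 1)) ^ (g x : ℤ)) (fun x => by simp [hnorm])
      (fun x => by simp [hnorm])).smul
      (∑ e ∈ Finset.range (N - 1), (ζ ^ (2 * m + 1)) ^ (-(e + 1 : ℤ)))).smul (1 / N)
  refine h.congr (fun x y => ?_) ?_
  · rw [sum_sum_zpow_skew_roots hN hζ (hg x) (hg y)]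
    split_ifs <;> field_simp
    simp
  · simp only [norm_sum_zpow_eq_abs_cot hN _ (hω _) (hωN _)]
    simp

theorem exp_half_mul_I (θ : ℝ) : Complex.exp (Complex.I * θ / 2) =
    Real.cos (θ / 2) + Complex.I * Real.sin (θ / 2) := by
  rw [Complex.ofReal_cos, Complex.ofReal_sin, mul_comm Complex.I (Complex.sin _),
    ← Complex.exp_mul_I]
  congr 1
  push_cast
  ring

theorem delta_eq (p : ℕ) (hp : 0 < p) : delta p = 1 / (2 ^ (p - 1) : ℕ) *
    ∑ m ∈ Finset.range (2 ^ (p - 1)),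
      |Real.cot ((2 * m + 1) * Real.pi / (2 * (2 ^ (p - 1) : ℕ)))| := by
  have h : ((2 : ℝ) ^ p) = 2 * (2 ^ (p - 1) : ℕ) := by
    push_cast
    rw [← pow_succ', Nat.sub_add_cancel hp]
  rw [delta, h]
  push_cast
  congr 1
  have hIcc : Finset.Icc 1 (2 ^ (p - 1)) = Finset.Ico 1 (2 ^ (p - 1) + 1) := by
    ext
    simp
  rw [hIcc, Finset.sum_Ico_eq_sum_range, Nat.add_sub_cancel]
  refine Finset.sum_congr rfl fun m _ => ?_
  push_cast
  ring_nf

theorem delta_pos (p : ℕ) (hp : 1 < p) : 0 < delta p := by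
  rw [delta]
  refine mul_pos (by positivity) (Finset.sum_pos' (fun _ _ => abs_nonneg _)
    ⟨1, Finset.mem_Icc.mpr ⟨le_rfl, Nat.one_le_two_pow⟩, ?_⟩)
  rw [abs_pos, Real.cot_eq_cos_div_sin]
  have h4 : (4 : ℝ) ≤ 2 ^ p := by
    calc (4 : ℝ) = 2 ^ 2 := by norm_num
      _ ≤ 2 ^ p := pow_le_pow_right₀ (by norm_num) hp
  have hpi := Real.pi_pos
  have hx0 : 0 < (2 * ((1 : ℕ) : ℝ) - 1) * Real.pi / 2 ^ p := by
    norm_num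
    positivity
  have hx1 : (2 * ((1 : ℕ) : ℝ) - 1) * Real.pi / 2 ^ p < Real.pi / 2 := by
    rw [div_lt_div_iff₀ (by positivity) (by norm_num)]
    norm_num
    nlinarith
  exact (div_pos (Real.cos_pos_of_mem_Ioo ⟨by linarith, hx1⟩)
    (Real.sin_pos_of_pos_of_lt_pi hx0 (by linarith))).ne'

/-- The bound for the Schur multiplication by the entries of `D(θ) - D(0)`. -/
def deformationBound (p : ℕ) (θ : ℝ) : ℝ :=
  2 * (1 - Real.cos (θ / 2)) + delta p * |Real.sin (θ / 2)|

theorem isSchurBound_matD_sub_one {p : ℕ} (hp : 0 < p) (θ : ℝ) (g : a → Fin (2 ^ p)) :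
    IsSchurBound (fun x y => matD p θ (g x) (g y) - 1) (deformationBound p θ) := by
  have hN : 2 ^ p = 2 * 2 ^ (p - 1) := by rw [← pow_succ', Nat.sub_add_cancel hp]
  have hpar := isSchurBound_eq (ι := Fin 1)
    fun x _ => (⟨(g x : ℕ) % 2, Nat.mod_lt _ two_pos⟩ : Fin 2)
  have heq := isSchurBound_eq fun x => finFunctionFinEquiv.symm (g x)
  have hsgn := isSchurBound_sign (N := 2 ^ (p - 1)) (by positivity) (fun x => (g x : ℕ) / 2)
    fun x => by have := (g x).2; omega
  rw [← delta_eq p hp] at hsgn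
  have hz := isSchurBound_mul_of_norm_le_one (u := fun x => (-1) ^ (g x : ℕ)) (w := fun _ => 1)
    (fun x => by simp) (fun x => by simp)
  have h1 := (hpar.add (heq.smul (-1))).smul (Real.cos (θ / 2) - 1 : ℝ)
  have h2 := ((hz.mul hpar zero_le_one).mul hsgn (by norm_num)).smul
    (Complex.I * Real.sin (θ / 2) : ℂ)
  refine (h1.add h2).congr (fun x y => ?_) ?_
  · simp only [matD, Matrix.of_apply, exp_half_mul_I, EmbeddingLike.apply_eq_iff_eq, Fin.ext_iff,
      funext_iff, forall_const]
    generalize (g x : ℕ) = i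
    generalize (g y : ℕ) = j
    have hstar : star ((Real.cos (θ / 2) : ℂ) + Complex.I * Real.sin (θ / 2)) =
        Real.cos (θ / 2) - Complex.I * Real.sin (θ / 2) := by
      simp only [star_add, star_mul', Complex.star_def, Complex.conj_ofReal, Complex.conj_I]
      ring
    have hsign : (-1 : ℂ) ^ i = if i % 2 = 0 then 1 else -1 := by
      split_ifs with h
      · exact (Nat.even_iff.mpr h).neg_one_pow
      · exact (Nat.odd_iff.mpr (by omega)).neg_one_pow
    have hij : i = j ↔ i / 2 = j / 2 ∧ i % 2 = j % 2 := by omega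
    rw [hstar, hsign, Complex.ofReal_sub, Complex.ofReal_one]
    simp only [hij]
    generalize (Real.cos (θ / 2) : ℂ) = c
    generalize (Real.sin (θ / 2) : ℂ) = s
    clear hij hsign hstar
    generalize i / 2 = i₁
    generalize j / 2 = j₁
    generalize i % 2 = i₂
    generalize j % 2 = j₂
    split_ifs <;> first | (exfalso; omega) | ring
  · have hc : |Real.cos (θ / 2) - 1| = 1 - Real.cos (θ / 2) := by
      rw [abs_sub_comm, abs_of_nonneg (sub_nonneg.mpr (Real.cos_le_one _))]
    simp only [Complex.norm_real, Real.norm_eq_abs, norm_mul, Complex.norm_I, hc, norm_neg,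
      norm_one, deformationBound]
    ring

theorem isSchurBound_prod_matD_sub_one {p n : ℕ} (hp : 0 < p) (θ : ℝ) :
    IsSchurBound (fun x y : Fin n → Fin (2 ^ p) => (∏ i, matD p θ (x i) (y i)) - 1)
      ((1 + deformationBound p θ) ^ n - 1) := by
  have hnonneg : 0 ≤ deformationBound p θ :=
    add_nonneg (mul_nonneg two_pos.le (sub_nonneg.mpr (Real.cos_le_one _)))
      (mul_nonneg (by unfold delta; positivity) (abs_nonneg _))
  have h := isSchurBound_sum (((Finset.univ : Finset (Fin n)).powerset).erase ∅) fun S _ =>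
    isSchurBound_prod S (fun i _ => isSchurBound_matD_sub_one hp θ
      fun x : Fin n → Fin (2 ^ p) => x i) fun _ _ => hnonneg
  have hempty : ∅ ∈ (Finset.univ : Finset (Fin n)).powerset := by simp
  refine h.congr (fun x y => ?_) ?_
  · have := Finset.prod_one_add (f := fun i => matD p θ (x i) (y i) - 1) Finset.univ
    simp only [add_sub_cancel] at this
    rw [this, ← Finset.add_sum_erase _ _ hempty, Finset.prod_empty, add_sub_cancel_left]
  · have := Finset.prod_one_add (f := fun _ : Fin n => deformationBound p θ) Finset.univ
    rw [← Finset.add_sum_erase _ _ hempty, Finset.prod_empty, Finset.prod_const,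
      Finset.card_univ, Fintype.card_fin] at this
    rw [this, add_sub_cancel_left]

end Schur

/-! ### Absence of codes for small deformations -/

section NoCode

open scoped Matrix.Norms.L2Operator

theorem sum_norm_le_of_forall_norm_sum_mul_le {s : Type*} [Fintype s] (z : s → ℂ) (C : ℝ)
    (h : ∀ d : s → ℂ, (∀ i, ‖d i‖ ≤ 1) → ‖∑ i, z i * d i‖ ≤ C) : ∑ i, ‖z i‖ ≤ C := by
  have h1 := h (fun i => star (z i) / (‖z i‖ : ℂ)) fun i => by
    rw [norm_div, norm_star, Complex.norm_real, norm_norm]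
    exact div_self_le_one _
  have h2 : ∀ i, z i * (star (z i) / (‖z i‖ : ℂ)) = (‖z i‖ : ℂ) := by
    intro i
    rw [← mul_div_assoc, Complex.star_def, Complex.mul_conj, Complex.normSq_eq_norm_sq]
    push_cast
    rw [sq, mul_self_div_self]
  simp only [h2] at h1
  rw [← Complex.ofReal_sum, Complex.norm_real, Real.norm_eq_abs] at h1
  exact (le_abs_self _).trans h1

variable {a s : Type*} [Fintype a] [DecidableEq a] [Fintype s] [DecidableEq s]

theorem norm_star_dotProduct_mulVec_le (A : Matrix a a ℂ) {φ ψ : a → ℂ}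
    (hφ : star φ ⬝ᵥ φ = 1) (hψ : star ψ ⬝ᵥ ψ = 1) : ‖star ψ ⬝ᵥ A.mulVec φ‖ ≤ ‖A‖ := by
  have hn : ∀ v : a → ℂ, star v ⬝ᵥ v = 1 → ‖WithLp.toLp 2 v‖ = 1 := by
    intro v hv
    have h : inner ℂ (WithLp.toLp 2 v) (WithLp.toLp 2 v) = (1 : ℂ) := by
      rw [EuclideanSpace.inner_eq_star_dotProduct, dotProduct_comm]
      exact hv
    rw [inner_self_eq_norm_sq_to_K] at h
    have h' : ‖WithLp.toLp 2 v‖ ^ 2 = 1 :=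
      Complex.ofReal_injective (by rw [Complex.ofReal_pow]; exact h)
    exact (pow_eq_one_iff_of_nonneg (norm_nonneg _) two_ne_zero).mp h'
  have h : star ψ ⬝ᵥ A.mulVec φ = inner ℂ (WithLp.toLp 2 ψ) (WithLp.toLp 2 (A.mulVec φ)) := by
    rw [EuclideanSpace.inner_eq_star_dotProduct, dotProduct_comm]
  rw [h]
  refine (norm_inner_le_norm _ _).trans ?_
  rw [hn ψ hψ, one_mul]
  have := Matrix.l2_opNorm_mulVec A (WithLp.toLp 2 φ)
  rwa [hn φ hφ, mul_one] at this

theorem star_dotProduct_conj_diagonal (H : Matrix a s ℂ) (d : s → ℂ) (φ ψ : a → ℂ) :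
    star ψ ⬝ᵥ (H * Matrix.diagonal d * H.conjTranspose).mulVec φ =
      ∑ i, (star (H.conjTranspose.mulVec ψ i) * H.conjTranspose.mulVec φ i) * d i := by
  rw [← Matrix.mulVec_mulVec, ← Matrix.mulVec_mulVec, Matrix.dotProduct_mulVec,
    show Matrix.vecMul (star ψ) H = star (H.conjTranspose.mulVec ψ) by
      rw [Matrix.star_mulVec, Matrix.conjTranspose_conjTranspose]]
  simp only [dotProduct, Matrix.mulVec_diagonal, Pi.star_apply]
  exact Finset.sum_congr rfl fun i _ => by ring

theorem norm_conj_diagonal_le (H : Matrix a s ℂ) (hH : H.conjTranspose * H = 1) {d : s → ℂ}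
    (hd : ∀ i, ‖d i‖ ≤ 1) : ‖H * Matrix.diagonal d * H.conjTranspose‖ ≤ 1 := by
  have hH1 : ‖H‖ ≤ 1 := by
    have h := Matrix.l2_opNorm_conjTranspose_mul_self H
    have h1 : ‖(1 : Matrix s s ℂ)‖ ≤ 1 := by
      rw [← Matrix.diagonal_one, Matrix.l2_opNorm_diagonal]
      exact (pi_norm_le_iff_of_nonneg zero_le_one).mpr fun i => by simp
    rw [hH] at h
    nlinarith [norm_nonneg H]
  have hd1 : ‖Matrix.diagonal d‖ ≤ 1 := by
    rw [Matrix.l2_opNorm_diagonal]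
    exact (pi_norm_le_iff_of_nonneg zero_le_one).mpr hd
  calc _ ≤ ‖H * Matrix.diagonal d‖ * ‖H.conjTranspose‖ := Matrix.l2_opNorm_mul _ _
    _ ≤ ‖H‖ * ‖Matrix.diagonal d‖ * ‖H.conjTranspose‖ := by
      gcongr
      exact Matrix.l2_opNorm_mul _ _
    _ ≤ 1 * 1 * 1 := by
      rw [Matrix.l2_opNorm_conjTranspose]
      gcongr
    _ = 1 := by ring

/-- If the Schur multiplier `M` is close to the identity, then the image under it of a maximal
commutative algebra of matrices satisfies no two-dimensional Knill–Laflamme condition. -/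
theorem false_of_isSchurBound (H : Matrix a s ℂ) (hH : H.conjTranspose * H = 1)
    (hH' : H * H.conjTranspose = 1) {M : a → a → ℂ} {ε : ℝ}
    (hM : IsSchurBound (fun x y => M x y - 1) ε) (hε : ε < 1 / 2) {φ ψ : a → ℂ}
    (hφ : star φ ⬝ᵥ φ = 1) (hψ : star ψ ⬝ᵥ ψ = 1)
    (h0 : ∀ d : s → ℂ, star ψ ⬝ᵥ
      ((Matrix.of M).hadamard (H * Matrix.diagonal d * H.conjTranspose)).mulVec φ = 0)
    (h1 : ∀ d : s → ℂ, star φ ⬝ᵥ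
        ((Matrix.of M).hadamard (H * Matrix.diagonal d * H.conjTranspose)).mulVec φ =
      star ψ ⬝ᵥ ((Matrix.of M).hadamard (H * Matrix.diagonal d * H.conjTranspose)).mulVec ψ) :
    False := by
  have hε0 : 0 ≤ ε := by
    have : Nonempty a := by
      by_contra h
      rw [not_nonempty_iff] at h
      simp [dotProduct] at hφ
    have h := hM 1
    rw [norm_one, mul_one] at h
    exact (norm_nonneg _).trans h
  have key : ∀ d : s → ℂ, (∀ i, ‖d i‖ ≤ 1) → ∀ φ' ψ' : a → ℂ, star φ' ⬝ᵥ φ' = 1 →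
      star ψ' ⬝ᵥ ψ' = 1 →
      ‖star ψ' ⬝ᵥ ((Matrix.of M).hadamard (H * Matrix.diagonal d * H.conjTranspose)).mulVec φ' -
        star ψ' ⬝ᵥ (H * Matrix.diagonal d * H.conjTranspose).mulVec φ'‖ ≤ ε := by
    intro d hd φ' ψ' hφ' hψ'
    rw [← dotProduct_sub, ← Matrix.sub_mulVec]
    refine (norm_star_dotProduct_mulVec_le _ hφ' hψ').trans ?_
    have h := hM (H * Matrix.diagonal d * H.conjTranspose)
    have h2 : (Matrix.of M).hadamard (H * Matrix.diagonal d * H.conjTranspose) -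
        H * Matrix.diagonal d * H.conjTranspose =
        (Matrix.of fun x y => M x y - 1).hadamard (H * Matrix.diagonal d * H.conjTranspose) := by
      ext x y
      simp only [Matrix.sub_apply, Matrix.hadamard_apply, Matrix.of_apply]
      ring
    rw [h2]
    exact h.trans (mul_le_of_le_one_right hε0 (norm_conj_diagonal_le H hH hd))
  set α := H.conjTranspose.mulVec φ with hα
  set β := H.conjTranspose.mulVec ψ with hβ
  have hunit : ∀ v : a → ℂ, star v ⬝ᵥ v = 1 → ∑ i, ‖H.conjTranspose.mulVec v i‖ ^ 2 = 1 := by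
    intro v hv
    have h := star_dotProduct_conj_diagonal H (fun _ => 1) v v
    rw [Matrix.diagonal_one, Matrix.mul_one, hH', Matrix.one_mulVec, hv] at h
    have h2 : ∀ i, star (H.conjTranspose.mulVec v i) * H.conjTranspose.mulVec v i * 1 =
        ((‖H.conjTranspose.mulVec v i‖ ^ 2 : ℝ) : ℂ) := by
      intro i
      rw [mul_one, mul_comm, Complex.star_def, Complex.mul_conj, Complex.normSq_eq_norm_sq]
    simp only [h2] at h
    exact_mod_cast h.symm
  have e1 : ∑ i, ‖star (β i) * α i‖ ≤ ε := by
    refine sum_norm_le_of_forall_norm_sum_mul_le _ _ fun d hd => ?_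
    have h := key d hd φ ψ hφ hψ
    rwa [h0, zero_sub, norm_neg, star_dotProduct_conj_diagonal] at h
  have e2 : ∑ i, ‖star (α i) * α i - star (β i) * β i‖ ≤ 2 * ε := by
    refine sum_norm_le_of_forall_norm_sum_mul_le _ _ fun d hd => ?_
    have ha := key d hd φ φ hφ hφ
    have hb := key d hd ψ ψ hψ hψ
    rw [star_dotProduct_conj_diagonal, norm_sub_rev, h1] at ha
    rw [star_dotProduct_conj_diagonal] at hb
    simp only [sub_mul, Finset.sum_sub_distrib]
    have := (norm_add_le _ _).trans (add_le_add ha hb)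
    rw [sub_add_sub_cancel] at this
    linarith
  have e3 : ∑ i, (‖α i‖ ^ 2 + ‖β i‖ ^ 2) ≤
      ∑ i, (2 * ‖star (β i) * α i‖ + ‖star (α i) * α i - star (β i) * β i‖) := by
    refine Finset.sum_le_sum fun i _ => ?_
    have h : star (α i) * α i - star (β i) * β i = ((‖α i‖ ^ 2 - ‖β i‖ ^ 2 : ℝ) : ℂ) := by
      rw [mul_comm, mul_comm (star (β i)), Complex.star_def, Complex.mul_conj,
        Complex.mul_conj, Complex.normSq_eq_norm_sq, Complex.normSq_eq_norm_sq]
      push_cast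
      rfl
    rw [h, Complex.norm_real, Real.norm_eq_abs, norm_mul, norm_star]
    have hα0 := norm_nonneg (α i)
    have hβ0 := norm_nonneg (β i)
    rcases le_total ‖α i‖ ‖β i‖ with hle | hle
    · nlinarith [neg_abs_le (‖α i‖ ^ 2 - ‖β i‖ ^ 2)]
    · nlinarith [le_abs_self (‖α i‖ ^ 2 - ‖β i‖ ^ 2)]
  rw [Finset.sum_add_distrib, Finset.sum_add_distrib, hunit φ hφ, hunit ψ hψ,
    ← Finset.mul_sum] at e3
  linarith

end NoCode

/-! ### Simultaneous diagonalization of `𝔏₀` -/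

section Hadamard

/-- The unitary `2 × 2` Hadamard matrix. -/
def hadamard₂ : Matrix (Fin 2) (Fin 2) ℂ := ((Real.sqrt 2)⁻¹ : ℂ) • !![1, 1; 1, -1]

theorem inv_sqrt_two_mul_self : ((Real.sqrt 2 : ℂ)⁻¹) * (Real.sqrt 2 : ℂ)⁻¹ = 1 / 2 := by
  rw [← mul_inv, ← Complex.ofReal_mul, Real.mul_self_sqrt (by norm_num)]
  norm_num

theorem hadamard₂_conjTranspose : hadamard₂.conjTranspose = hadamard₂ := by
  ext i j
  fin_cases i <;> fin_cases j <;> simp [hadamard₂]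

theorem hadamard₂_mul_self : hadamard₂ * hadamard₂ = 1 := by
  rw [hadamard₂, Matrix.smul_mul, Matrix.mul_smul, smul_smul, inv_sqrt_two_mul_self]
  ext i j
  fin_cases i <;> fin_cases j <;> norm_num [Matrix.mul_apply, Fin.sum_univ_two]

theorem hadamard₂_mul_single_mul_mem (t : Fin 2) :
    hadamard₂ * Matrix.single t t (1 : ℂ) * hadamard₂.conjTranspose ∈ algA₂ := by
  have h : ∀ S : Matrix (Fin 2) (Fin 2) ℂ, hadamard₂ * S * hadamard₂.conjTranspose =
      (1 / 2 : ℂ) • (!![1, 1; 1, -1] * S * !![1, 1; 1, -1]) := fun S => by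
    rw [hadamard₂_conjTranspose, hadamard₂, Matrix.smul_mul, Matrix.smul_mul, Matrix.mul_smul,
      smul_smul, inv_sqrt_two_mul_self]
  rw [h]
  have h0 : Matrix.single 0 0 (1 : ℂ) = !![1, 0; 0, 0] := by
    ext i j
    fin_cases i <;> fin_cases j <;> simp
  have h1 : Matrix.single 1 1 (1 : ℂ) = !![0, 0; 0, 1] := by
    ext i j
    fin_cases i <;> fin_cases j <;> simp
  obtain rfl | rfl : t = 0 ∨ t = 1 := by omega
  · refine ⟨1 / 2, 1 / 2, ?_⟩
    rw [h0]
    simp [Matrix.smul_of]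
  · refine ⟨1 / 2, -1 / 2, ?_⟩
    rw [h1]
    simp [Matrix.smul_of, neg_div]

/-- The binary digits of an index. -/
def bitEquiv (p : ℕ) : Fin (2 ^ p) ≃ (Fin p → Fin 2) :=
  finFunctionFinEquiv.symm.trans (Equiv.arrowCongr Fin.revPerm (Equiv.refl _))

theorem coe_bitEquiv (p : ℕ) : ⇑(bitEquiv p) = bit p := rfl

/-- The unitary matrix whose columns are the common eigenvectors of `𝔏₀`. -/
def hadamardMatrix (p : ℕ) : Matrix (Fin (2 ^ p)) (Fin p → Fin 2) ℂ :=
  (tensor fun _ => hadamard₂).submatrix (bit p) id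

theorem tensor_hadamard₂_mul_conjTranspose (p : ℕ) :
    tensor (fun _ : Fin p => hadamard₂) * (tensor fun _ : Fin p => hadamard₂).conjTranspose = 1 := by
  rw [tensor_conjTranspose, tensor_mul_tensor]
  simp only [hadamard₂_conjTranspose, hadamard₂_mul_self, tensor_one]

theorem hadamardMatrix_mul_conjTranspose (p : ℕ) :
    hadamardMatrix p * (hadamardMatrix p).conjTranspose = 1 := by
  rw [hadamardMatrix, Matrix.conjTranspose_submatrix, ← Matrix.submatrix_mul _ _ _ id _
    Function.bijective_id, tensor_hadamard₂_mul_conjTranspose, ← coe_bitEquiv,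
    Matrix.submatrix_one_equiv]

theorem hadamardMatrix_conjTranspose_mul (p : ℕ) :
    (hadamardMatrix p).conjTranspose * hadamardMatrix p = 1 := by
  rw [hadamardMatrix, Matrix.conjTranspose_submatrix, ← Matrix.submatrix_mul _ _ id (bit p) _
    (bitEquiv p).bijective, tensor_conjTranspose, tensor_mul_tensor]
  simp only [hadamard₂_conjTranspose, hadamard₂_mul_self, tensor_one, Matrix.submatrix_id_id]

theorem hadamardMatrix_mul_single_mul_mem (p : ℕ) (t : Fin p → Fin 2) :
    hadamardMatrix p * Matrix.single t t (1 : ℂ) * (hadamardMatrix p).conjTranspose ∈ algL₀ p := by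
  refine Submodule.subset_span
    ⟨fun l => hadamard₂ * Matrix.single (t l) (t l) (1 : ℂ) * hadamard₂.conjTranspose,
      fun l => hadamard₂_mul_single_mul_mem _, ?_⟩
  rw [← tensor_mul_tensor, ← tensor_mul_tensor, ← tensor_conjTranspose, tensor_single,
    hadamardMatrix, Matrix.conjTranspose_submatrix,
    Matrix.submatrix_mul _ _ (bit p) id (bit p) Function.bijective_id,
    Matrix.submatrix_mul _ _ (bit p) id id Function.bijective_id, Matrix.submatrix_id_id]

/-- The tensor power of `hadamardMatrix p`. -/
def hadamardPower (p n : ℕ) : Matrix (Fin n → Fin (2 ^ p)) (Fin n → Fin p → Fin 2) ℂ :=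
  tensor fun _ => hadamardMatrix p

theorem hadamardPower_mul_conjTranspose (p n : ℕ) :
    hadamardPower p n * (hadamardPower p n).conjTranspose = 1 := by
  rw [hadamardPower, tensor_conjTranspose, tensor_mul_tensor]
  simp only [hadamardMatrix_mul_conjTranspose, tensor_one]

theorem hadamardPower_conjTranspose_mul (p n : ℕ) :
    (hadamardPower p n).conjTranspose * hadamardPower p n = 1 := by
  rw [hadamardPower, tensor_conjTranspose, tensor_mul_tensor]
  simp only [hadamardMatrix_conjTranspose_mul, tensor_one]

theorem hadamard_conj_diagonal_eq_sum (p n : ℕ) (θ : ℝ) (d : (Fin n → Fin p → Fin 2) → ℂ) :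
    (Matrix.of fun x y : Fin n → Fin (2 ^ p) => ∏ i, matD p θ (x i) (y i)).hadamard
        (hadamardPower p n * Matrix.diagonal d * (hadamardPower p n).conjTranspose) =
      ∑ t, d t • tensor fun i => (matD p θ).hadamard
        (hadamardMatrix p * Matrix.single (t i) (t i) (1 : ℂ) * (hadamardMatrix p).conjTranspose) := by
  have h1 : Matrix.diagonal d = ∑ t, d t • Matrix.single t t (1 : ℂ) := by
    ext i j
    simp only [Matrix.sum_apply, Matrix.smul_apply, Matrix.single_apply, Matrix.diagonal_apply,
      smul_eq_mul, mul_ite, mul_one, mul_zero]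
    by_cases hij : i = j
    · simp [hij]
    · rw [if_neg hij, Finset.sum_eq_zero fun t _ => if_neg fun h => hij (h.1.symm.trans h.2)]
  rw [h1, Matrix.mul_sum, Matrix.sum_mul]
  ext x y
  simp only [Matrix.hadamard_apply, Matrix.sum_apply, Finset.mul_sum]
  refine Finset.sum_congr rfl fun t _ => ?_
  rw [← tensor_single, hadamardPower, tensor_conjTranspose, Matrix.mul_smul, Matrix.smul_mul,
    tensor_mul_tensor, tensor_mul_tensor]
  simp only [Matrix.smul_apply, Matrix.of_apply, tensor_apply, Matrix.hadamard_apply,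
    Finset.prod_mul_distrib, smul_eq_mul]
  ring

end Hadamard

/-! ### Vanishing of the capacity -/

section Capacity

theorem star_dotProduct_tensor_eq_zero {a b : Type*} [Fintype a] [DecidableEq a] [Fintype b]
    [DecidableEq b] {n : ℕ} {Φ : Matrix a a ℂ →ₗ[ℂ] Matrix b b ℂ}
    {H₀ : Submodule ℂ (EuclideanSpace ℂ (Fin n → a))}
    (hH : IsErrorCorrectingCode (tensorPower n Φ) H₀) {φ ψ : (Fin n → a) → ℂ}
    (hφm : WithLp.toLp 2 φ ∈ H₀) (hψm : WithLp.toLp 2 ψ ∈ H₀)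
    (hφ : star φ ⬝ᵥ φ = 1) (hψ : star ψ ⬝ᵥ ψ = 1) (hφψ : star φ ⬝ᵥ ψ = 0)
    (A : Fin n → Matrix a a ℂ) (hA : ∀ i, A i ∈ noncommutativeGraph Φ) :
    star φ ⬝ᵥ (tensor A).mulVec ψ = 0 := by
  choose d V hV X hX using hA
  obtain ⟨Θ, hΘ, hrec⟩ := hH
  have hK := tensorPower_eq_krausMap (n := n) (fun i => krausOf (V i)) fun i => (hV i).eq_krausMap
  have h0 := dotProduct_eq_zero_of_recovery (fun e : ∀ i, Fin (d i) =>
    tensor fun i => krausOf (V i) (e i)) hΘ hφ hφψ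
    (hK ▸ hrec _ (isStateOn_vecMulVec hφ hφm)) (hK ▸ hrec _ (isStateOn_vecMulVec hψ hψm))
  have hA' : tensor A = ∑ q : ∀ i, Fin (d i) × Fin (d i), (∏ i, X i (q i).1 (q i).2) •
      ((tensor fun i => krausOf (V i) (q i).1).conjTranspose *
        tensor fun i => krausOf (V i) (q i).2) := by
    have : A = fun i => ∑ q : Fin (d i) × Fin (d i), X i q.1 q.2 •
        ((krausOf (V i) q.1).conjTranspose * krausOf (V i) q.2) :=
      funext fun i => by rw [← complementaryDual_eq_sum, hX]
    rw [this, tensor_sum]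
    simp only [tensor_smul, tensor_conjTranspose, tensor_mul_tensor]
  rw [hA', Matrix.sum_mulVec, dotProduct_sum]
  refine Finset.sum_eq_zero fun q _ => ?_
  rw [Matrix.smul_mulVec, dotProduct_smul, ← Matrix.mulVec_mulVec, Matrix.dotProduct_mulVec,
    ← Matrix.star_mulVec, h0 (fun i => (q i).1) (fun i => (q i).2), smul_zero]

theorem finrank_le_one_of_isErrorCorrectingCode {p n : ℕ} (hp : 0 < p) {θ : ℝ} {B : Type*}
    [Fintype B] [DecidableEq B] {Φ : Matrix (Fin (2 ^ p)) (Fin (2 ^ p)) ℂ →ₗ[ℂ] Matrix B B ℂ}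
    (hG : noncommutativeGraph Φ = spaceL p θ)
    (hθ : (1 + deformationBound p θ) ^ n - 1 < 1 / 2)
    {H₀ : Submodule ℂ (EuclideanSpace ℂ (Fin n → Fin (2 ^ p)))}
    (hH : IsErrorCorrectingCode (tensorPower n Φ) H₀) : Module.finrank ℂ H₀ ≤ 1 := by
  by_contra! hdim
  have hdot : ∀ u v : EuclideanSpace ℂ (Fin n → Fin (2 ^ p)),
      star u.ofLp ⬝ᵥ v.ofLp = inner ℂ u v := fun u v => by
    rw [EuclideanSpace.inner_eq_star_dotProduct, dotProduct_comm]
  set b := stdOrthonormalBasis ℂ H₀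
  set φ : (Fin n → Fin (2 ^ p)) → ℂ := (b ⟨0, by omega⟩ : EuclideanSpace ℂ _).ofLp with hφdef
  set ψ : (Fin n → Fin (2 ^ p)) → ℂ := (b ⟨1, hdim⟩ : EuclideanSpace ℂ _).ofLp with hψdef
  have hφm : WithLp.toLp 2 φ ∈ H₀ := (b ⟨0, by omega⟩).2
  have hψm : WithLp.toLp 2 ψ ∈ H₀ := (b ⟨1, hdim⟩).2
  have hb := orthonormal_iff_ite.mp b.orthonormal
  have hφ : star φ ⬝ᵥ φ = 1 := by
    rw [hdot, ← Submodule.coe_inner, hb, if_pos rfl]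
  have hψ : star ψ ⬝ᵥ ψ = 1 := by
    rw [hdot, ← Submodule.coe_inner, hb, if_pos rfl]
  have hφψ : star φ ⬝ᵥ ψ = 0 := by
    rw [hdot, ← Submodule.coe_inner, hb, if_neg (by simp)]
  have hψφ : star ψ ⬝ᵥ φ = 0 := by
    rw [hdot, ← Submodule.coe_inner, hb, if_neg (by simp)]
  have hmem : ∀ t : Fin p → Fin 2, (matD p θ).hadamard
      (hadamardMatrix p * Matrix.single t t (1 : ℂ) * (hadamardMatrix p).conjTranspose) ∈
      noncommutativeGraph Φ := fun t => by
    rw [hG]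
    exact ⟨_, hadamardMatrix_mul_single_mul_mem p t, rfl⟩
  have hzero : ∀ φ' ψ' : (Fin n → Fin (2 ^ p)) → ℂ, WithLp.toLp 2 φ' ∈ H₀ →
      WithLp.toLp 2 ψ' ∈ H₀ → star φ' ⬝ᵥ φ' = 1 → star ψ' ⬝ᵥ ψ' = 1 → star ψ' ⬝ᵥ φ' = 0 →
      ∀ d : (Fin n → Fin p → Fin 2) → ℂ, star ψ' ⬝ᵥ ((Matrix.of fun x y : Fin n → Fin (2 ^ p) =>
        ∏ i, matD p θ (x i) (y i)).hadamard (hadamardPower p n * Matrix.diagonal d *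
          (hadamardPower p n).conjTranspose)).mulVec φ' = 0 := by
    intro φ' ψ' hφm' hψm' hφ' hψ' ho d
    rw [hadamard_conj_diagonal_eq_sum, Matrix.sum_mulVec, dotProduct_sum]
    refine Finset.sum_eq_zero fun t _ => ?_
    rw [Matrix.smul_mulVec, dotProduct_smul,
      star_dotProduct_tensor_eq_zero hH hψm' hφm' hψ' hφ' ho _ fun i => hmem _, smul_zero]
  refine false_of_isSchurBound (hadamardPower p n) (hadamardPower_conjTranspose_mul p n)
    (hadamardPower_mul_conjTranspose p n) (isSchurBound_prod_matD_sub_one hp θ) hθ hφ hψ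
    (hzero φ ψ hφm hψm hφ hψ hψφ) fun d => ?_
  set r : ℂ := (Real.sqrt 2 : ℂ)⁻¹ with hr
  have hrr : r * r = 1 / 2 := inv_sqrt_two_mul_self
  have hrs : star r = r := by simp [hr]
  have hsum := hzero (r • (φ + ψ)) (r • (φ - ψ))
    (H₀.smul_mem r (H₀.add_mem hφm hψm)) (H₀.smul_mem r (H₀.sub_mem hφm hψm))
    (by simp only [star_smul, star_add, smul_dotProduct, dotProduct_smul, add_dotProduct,
          dotProduct_add, hφ, hψ, hφψ, hψφ, hrs, smul_eq_mul]
        linear_combination 2 * hrr)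
    (by simp only [star_smul, star_sub, smul_dotProduct, dotProduct_smul, sub_dotProduct,
          dotProduct_sub, hφ, hψ, hφψ, hψφ, hrs, smul_eq_mul]
        linear_combination 2 * hrr)
    (by simp only [star_smul, star_sub, smul_dotProduct, dotProduct_smul, sub_dotProduct,
          dotProduct_add, hφ, hψ, hφψ, hψφ, hrs, smul_eq_mul]
        ring) d
  have h1 := hzero φ ψ hφm hψm hφ hψ hψφ d
  have h2 := hzero ψ φ hψm hφm hψ hφ hφψ d
  simp only [star_smul, star_sub, Matrix.mulVec_smul, Matrix.mulVec_add, smul_dotProduct,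
    dotProduct_smul, sub_dotProduct, dotProduct_add, h1, h2, hrs, smul_eq_mul] at hsum
  simp only [sub_zero, zero_sub, ← mul_add, ← mul_assoc, hrr] at hsum
  linear_combination 2 * hsum

theorem one_add_pow_sub_one_lt {n : ℕ} (hn : 0 < n) {x : ℝ} (hx0 : 0 ≤ x)
    (hx : x ≤ (n : ℝ)⁻¹ * Real.log (3 / 2)) : (1 + x) ^ n - 1 < 1 / 2 := by
  rcases hx0.eq_or_lt with rfl | hx0
  · norm_num
  · have h1 : (1 + x) ^ n < Real.exp x ^ n :=
      pow_lt_pow_left₀ (by linarith [Real.add_one_lt_exp hx0.ne']) (by positivity) hn.ne'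
    have h2 : Real.exp x ^ n ≤ 3 / 2 := by
      rw [← Real.exp_nat_mul, ← Real.le_log_iff_exp_le (by norm_num)]
      have hn' : (0 : ℝ) < n := by exact_mod_cast hn
      calc n * x ≤ n * ((n : ℝ)⁻¹ * Real.log (3 / 2)) := by gcongr
        _ = Real.log (3 / 2) := by field_simp
    linarith

theorem exists_isLeast_threshold {δ L : ℝ} (hδ : 0 < δ) (hL : 0 < L) (hL2 : L ≤ 2) :
    ∃ t₀ : ℝ, IsLeast {t : ℝ | 0 < t ∧
        2 * (1 - Real.cos (t / 2)) + δ * Real.sin (t / 2) = L} t₀ ∧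
      ∀ t, 0 ≤ t → t ≤ t₀ → 2 * (1 - Real.cos (t / 2)) + δ * Real.sin (t / 2) ≤ L := by
  set f : ℝ → ℝ := fun t => 2 * (1 - Real.cos (t / 2)) + δ * Real.sin (t / 2) with hf
  have hcont : Continuous f := by fun_prop
  have hf0 : f 0 = 0 := by simp [hf]
  have hfpi : L ≤ f Real.pi := by
    simp only [hf, Real.cos_pi_div_two, Real.sin_pi_div_two]
    linarith
  obtain ⟨t₁, ht₁, hft₁⟩ := intermediate_value_Icc Real.pi_pos.le hcont.continuousOn
    (show L ∈ Set.Icc (f 0) (f Real.pi) from ⟨by rw [hf0]; exact hL.le, hfpi⟩)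
  have hcomp : IsCompact (Set.Icc 0 Real.pi ∩ f ⁻¹' {L}) :=
    isCompact_Icc.inter_right (isClosed_singleton.preimage hcont)
  obtain ⟨t₀, ⟨⟨ht₀0, ht₀pi⟩, hft₀⟩, hmin⟩ := hcomp.exists_isLeast ⟨t₁, ht₁, hft₁⟩
  have hft₀' : f t₀ = L := hft₀
  have hpos : 0 < t₀ := by
    refine lt_of_le_of_ne ht₀0 ?_
    rintro rfl
    linarith
  have hleast : ∀ t, 0 < t → f t = L → t₀ ≤ t := by
    intro t ht hft
    rcases le_total t Real.pi with h | h
    · exact hmin ⟨⟨ht.le, h⟩, hft⟩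
    · exact ht₀pi.trans h
  refine ⟨t₀, ⟨⟨hpos, hft₀'⟩, fun t ht => hleast t ht.1 ht.2⟩, fun t ht0 ht => ?_⟩
  by_contra! hlt
  obtain ⟨t', ht', hft'⟩ := intermediate_value_Icc ht0 hcont.continuousOn
    (show L ∈ Set.Icc (f 0) (f t) from ⟨by rw [hf0]; exact hL.le, hlt.le⟩)
  have h0 : 0 < t' := by
    refine lt_of_le_of_ne ht'.1 ?_
    rintro rfl
    linarith
  have h1 := hleast t' h0 hft'
  have h2 : t' = t := le_antisymm ht'.2 (ht.trans h1)
  rw [h2] at hft'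
  exact hlt.ne' hft'

theorem oneShotCapacity_eq_zero {p n : ℕ} (hp : 0 < p) {θ : ℝ} {B : Type*}
    [Fintype B] [DecidableEq B] {Φ : Matrix (Fin (2 ^ p)) (Fin (2 ^ p)) ℂ →ₗ[ℂ] Matrix B B ℂ}
    (hG : noncommutativeGraph Φ = spaceL p θ)
    (hθ : (1 + deformationBound p θ) ^ n - 1 < 1 / 2) :
    oneShotCapacity (tensorPower n Φ) = 0 := by
  have h : ∀ r ∈ {r | ∃ H₀ : Submodule ℂ (EuclideanSpace ℂ (Fin n → Fin (2 ^ p))),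
      H₀ ≠ ⊥ ∧ IsErrorCorrectingCode (tensorPower n Φ) H₀ ∧
        r = Real.logb 2 (Module.finrank ℂ H₀)}, r = 0 := by
    rintro r ⟨H₀, hne, hH, rfl⟩
    have h1 := finrank_le_one_of_isErrorCorrectingCode hp hG hθ hH
    have h2 : Module.finrank ℂ H₀ ≠ 0 := fun h => hne (Submodule.finrank_eq_zero.mp h)
    rw [show Module.finrank ℂ H₀ = 1 by omega]
    simp
  exact le_antisymm (Real.sSup_nonpos fun r hr => (h r hr).le)
    (Real.sSup_nonneg fun r hr => (h r hr).ge)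

end Capacity

/-! ### The structure of the deformed algebra -/

section Structure

theorem coe_bit (p : ℕ) (i : Fin (2 ^ p)) (l : Fin p) :
    (bit p i l : ℕ) = (i : ℕ) / 2 ^ (l.rev : ℕ) % 2 := by
  simp [bit, finFunctionFinEquiv]

theorem exists_of_mem_algL₀ {p : ℕ} {A : Matrix (Fin (2 ^ p)) (Fin (2 ^ p)) ℂ}
    (hA : A ∈ algL₀ p) : ∃ f : (Fin p → Fin 2) → ℂ, ∀ i j, A i j = f (bit p i + bit p j) := by
  induction hA using Submodule.span_induction with
  | mem A hA =>
    obtain ⟨M, hM, rfl⟩ := hA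
    choose u v huv using hM
    refine ⟨fun t => ∏ l, if t l = 0 then u l else v l, fun i j => ?_⟩
    simp only [Matrix.submatrix_apply, tensor_apply, Pi.add_apply]
    refine Finset.prod_congr rfl fun l _ => ?_
    have h : ∀ x y : Fin 2, !![u l, v l; v l, u l] x y = if x + y = 0 then u l else v l := by
      intro x y
      fin_cases x <;> fin_cases y <;> simp
    rw [huv, h]
  | zero => exact ⟨0, fun i j => rfl⟩
  | add A B _ _ hA hB =>
    obtain ⟨f, hf⟩ := hA
    obtain ⟨g, hg⟩ := hB
    exact ⟨f + g, fun i j => by rw [Matrix.add_apply, hf, hg, Pi.add_apply]⟩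
  | smul c A _ hA =>
    obtain ⟨f, hf⟩ := hA
    exact ⟨c • f, fun i j => by rw [Matrix.smul_apply, hf, Pi.smul_apply]⟩

theorem bit_add_bit_self (p : ℕ) (i : Fin (2 ^ p)) : bit p i + bit p i = 0 := by
  ext l
  rw [Pi.add_apply]
  generalize bit p i l = x
  fin_cases x <;> rfl

theorem bit_rev (p : ℕ) (i : Fin (2 ^ p)) : bit p i.rev = bit p i + 1 := by
  ext l
  have h := Nat.testBit_two_pow_sub_succ i.2 (l.rev : ℕ)
  rw [Nat.testBit_eq_decide_div_mod_eq, Nat.testBit_eq_decide_div_mod_eq] at h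
  have h1 := coe_bit p i l
  have h2 := coe_bit p i.rev l
  rw [Fin.val_rev] at h2
  simp only [Fin.is_lt, decide_true, Bool.true_and, ← h1, ← h2] at h
  rw [Pi.add_apply, Pi.one_apply]
  revert h
  generalize bit p i l = x
  generalize bit p i.rev l = y
  fin_cases x <;> fin_cases y <;> simp

theorem bit_rev_add_bit_rev (p : ℕ) (i j : Fin (2 ^ p)) :
    bit p i.rev + bit p j.rev = bit p i + bit p j := by
  rw [bit_rev, bit_rev]
  ext l
  simp only [Pi.add_apply, Pi.one_apply]
  generalize bit p i l = x
  generalize bit p j l = y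
  fin_cases x <;> fin_cases y <;> rfl

theorem bit_add_bit_eq {p : ℕ} {i j i' j' : Fin (2 ^ p)} (hi : (i : ℕ) / 2 = (i' : ℕ) / 2)
    (hj : (j : ℕ) / 2 = (j' : ℕ) / 2)
    (hij : ((i : ℕ) + j) % 2 = ((i' : ℕ) + j') % 2) :
    bit p i + bit p j = bit p i' + bit p j' := by
  ext l
  rw [Pi.add_apply, Pi.add_apply, Fin.val_add, Fin.val_add]
  simp only [coe_bit]
  cases hm : (l.rev : ℕ) with
  | zero => simpa [Nat.add_mod] using hij
  | succ m => rw [pow_succ', ← Nat.div_div_eq_div_mul, ← Nat.div_div_eq_div_mul,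
      ← Nat.div_div_eq_div_mul, ← Nat.div_div_eq_div_mul, hi, hj]

theorem exists_of_mem_spaceL {p : ℕ} {θ : ℝ} {A : Matrix (Fin (2 ^ p)) (Fin (2 ^ p)) ℂ}
    (hA : A ∈ spaceL p θ) :
    ∃ f : (Fin p → Fin 2) → ℂ, ∀ i j, A i j = matD p θ i j * f (bit p i + bit p j) := by
  obtain ⟨A, hA, rfl⟩ := hA
  obtain ⟨f, hf⟩ := exists_of_mem_algL₀ hA
  exact ⟨f, fun i j => by simp [hf]⟩

theorem matD_rev {p : ℕ} (hp : 0 < p) (θ : ℝ) (i j : Fin (2 ^ p)) :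
    matD p θ i.rev j.rev = matD p θ i j := by
  have hN : 2 ^ p = 2 * 2 ^ (p - 1) := by rw [← pow_succ', Nat.sub_add_cancel hp]
  have hi := i.2
  have hj := j.2
  simp only [matD, Matrix.of_apply, Fin.val_rev]
  split_ifs <;> first | rfl | (exfalso; omega)

theorem matW_mul_apply {p : ℕ} (A : Matrix (Fin (2 ^ p)) (Fin (2 ^ p)) ℂ) (i j) :
    (matW p * A) i j = A i.rev j := by
  simp only [Matrix.mul_apply, matW, Matrix.of_apply, ite_mul, one_mul, zero_mul]
  rw [Finset.sum_eq_single i.rev]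
  · rw [if_pos (Fin.rev_rev i).symm]
  · exact fun b _ hb => if_neg fun h => hb (by rw [h, Fin.rev_rev])
  · simp

theorem mul_matW_apply {p : ℕ} (A : Matrix (Fin (2 ^ p)) (Fin (2 ^ p)) ℂ) (i j) :
    (A * matW p) i j = A i j.rev := by
  simp [Matrix.mul_apply, matW]

theorem matW_conjTranspose (p : ℕ) : (matW p).conjTranspose = matW p := by
  ext i j
  simp only [matW, Matrix.conjTranspose_apply, Matrix.of_apply, apply_ite star, star_one, star_zero]
  exact if_congr ⟨fun h => by rw [h, Fin.rev_rev], fun h => by rw [h, Fin.rev_rev]⟩ rfl rfl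

theorem matW_mul_matW (p : ℕ) : matW p * matW p = 1 := by
  ext i j
  rw [matW_mul_apply, matW, Matrix.of_apply, Matrix.one_apply]
  exact if_congr Fin.rev_inj rfl rfl

theorem matW_mul_mul_matW {p : ℕ} (hp : 0 < p) {θ : ℝ}
    {A : Matrix (Fin (2 ^ p)) (Fin (2 ^ p)) ℂ} (hA : A ∈ spaceL p θ) :
    matW p * A * matW p = A := by
  obtain ⟨f, hf⟩ := exists_of_mem_spaceL hA
  ext i j
  rw [mul_matW_apply, matW_mul_apply, hf, hf, matD_rev hp, bit_rev_add_bit_rev]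

end Structure

/-! ### The explicit codes -/

section Codes

variable {p n : ℕ}

/-- The index `2 k + e` of the canonical basis. -/
def blockIndex (hp : 0 < p) (k : Fin (2 ^ (p - 1))) (e : Fin 2) : Fin (2 ^ p) :=
  ⟨2 * k + e, by
    have hN : 2 ^ p = 2 * 2 ^ (p - 1) := by rw [← pow_succ', Nat.sub_add_cancel hp]
    have := k.2
    have := e.2
    omega⟩

theorem coe_blockIndex (hp : 0 < p) (k : Fin (2 ^ (p - 1))) (e : Fin 2) :
    (blockIndex hp k e : ℕ) = 2 * k + e := rfl

theorem ket_eq_single (i : Fin (2 ^ p)) :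
    (ket p n i).ofLp = Pi.single (fun _ => i) 1 := by
  ext y
  simp only [ket, Pi.single_apply, funext_iff, Fin.ext_iff]

theorem vecPhi_eq (hp : 0 < p) (k : Fin (2 ^ (p - 1))) :
    (vecPhi p n k).ofLp = ((Real.sqrt 2 : ℂ)⁻¹) • (Pi.single (fun _ => blockIndex hp k 0) 1 +
      Complex.I • Pi.single (fun _ => blockIndex hp k 1) 1) := by
  rw [← ket_eq_single, ← ket_eq_single]
  simp [vecPhi, coe_blockIndex]

theorem star_vecPhi_dotProduct_tensor_mulVec (hp : 0 < p)
    (C : Fin n → Matrix (Fin (2 ^ p)) (Fin (2 ^ p)) ℂ) (k l : Fin (2 ^ (p - 1)))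
    (hC : ∀ i, C i (blockIndex hp k 0) (blockIndex hp l 1) =
      C i (blockIndex hp k 1) (blockIndex hp l 0)) :
    star (vecPhi p n k).ofLp ⬝ᵥ (tensor C).mulVec (vecPhi p n l).ofLp =
      1 / 2 * (∏ i, C i (blockIndex hp k 0) (blockIndex hp l 0) +
        ∏ i, C i (blockIndex hp k 1) (blockIndex hp l 1)) := by
  have hsingle : ∀ x y : Fin n → Fin (2 ^ p),
      star (Pi.single x (1 : ℂ)) ⬝ᵥ (tensor C).mulVec (Pi.single y (1 : ℂ)) = ∏ i, C i (x i) (y i) := by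
    intro x y
    rw [Matrix.mulVec_single_one, ← Pi.single_star, star_one, single_one_dotProduct]
    rfl
  have hs : star ((Real.sqrt 2 : ℂ)⁻¹) = (Real.sqrt 2 : ℂ)⁻¹ := by simp
  rw [vecPhi_eq hp, vecPhi_eq hp]
  simp only [star_smul, star_add, Matrix.mulVec_smul, Matrix.mulVec_add, smul_dotProduct,
    dotProduct_smul, add_dotProduct, dotProduct_add, hsingle, hs, hC, smul_eq_mul, Complex.star_def,
    Complex.conj_I]
  linear_combination (∏ i, C i (blockIndex hp k 0) (blockIndex hp l 0) +
    ∏ i, C i (blockIndex hp k 1) (blockIndex hp l 1)) * inv_sqrt_two_mul_self -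
    (Real.sqrt 2 : ℂ)⁻¹ * (Real.sqrt 2 : ℂ)⁻¹ *
      (∏ i, C i (blockIndex hp k 1) (blockIndex hp l 1)) * Complex.I_mul_I

theorem one_apply_blockIndex (hp : 0 < p) (k l : Fin (2 ^ (p - 1))) (e f : Fin 2) :
    (1 : Matrix (Fin (2 ^ p)) (Fin (2 ^ p)) ℂ) (blockIndex hp k e) (blockIndex hp l f) =
      if k = l ∧ e = f then 1 else 0 := by
  rw [Matrix.one_apply]
  refine if_congr ?_ rfl rfl
  simp only [Fin.ext_iff, coe_blockIndex]
  omega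

theorem matW_apply_blockIndex (hp : 0 < p) (k l : Fin (2 ^ (p - 1))) (e f : Fin 2) :
    matW p (blockIndex hp k e) (blockIndex hp l f) = if k = l.rev ∧ e ≠ f then 1 else 0 := by
  have hN : 2 ^ p = 2 * 2 ^ (p - 1) := by rw [← pow_succ', Nat.sub_add_cancel hp]
  rw [matW, Matrix.of_apply]
  refine if_congr ?_ rfl rfl
  simp only [Fin.ext_iff, Fin.val_rev, coe_blockIndex, ne_eq]
  have := k.2
  have := l.2
  omega

theorem star_vecPhi_dotProduct_vecPhi (hp : 0 < p) (k l : Fin (2 ^ (p - 1))) (hn : 0 < n) :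
    star (vecPhi p n k).ofLp ⬝ᵥ (vecPhi p n l).ofLp = if k = l then 1 else 0 := by
  have h := star_vecPhi_dotProduct_tensor_mulVec (n := n) hp (fun _ => 1) k l
    fun i => by simp [one_apply_blockIndex]
  rw [tensor_one, Matrix.one_mulVec] at h
  rw [h]
  simp only [one_apply_blockIndex]
  by_cases hkl : k = l
  · norm_num [hkl]
  · simp [hkl, hn.ne']

theorem matU_conjTranspose (x : Fin n → Fin 2) : (matU p n x).conjTranspose = matU p n x := by
  rw [matU, tensor_conjTranspose]
  congr 1
  ext1 i
  split_ifs
  · exact Matrix.conjTranspose_one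
  · exact matW_conjTranspose p

theorem matU_mul_matU (x y : Fin n → Fin 2) :
    matU p n x * matU p n y = tensor fun i => if x i = y i then 1 else matW p := by
  rw [matU, matU, tensor_mul_tensor]
  congr 1
  ext1 i
  generalize x i = u
  generalize y i = v
  fin_cases u <;> fin_cases v <;> simp [matW_mul_matW]

theorem matU_mul_self (x : Fin n → Fin 2) : matU p n x * matU p n x = 1 := by
  rw [matU_mul_matU]
  simp only [if_true, tensor_one]

theorem matU_mul_tensor_mul_matU (hp : 0 < p) {θ : ℝ} (x : Fin n → Fin 2)
    {A : Fin n → Matrix (Fin (2 ^ p)) (Fin (2 ^ p)) ℂ} (hA : ∀ i, A i ∈ spaceL p θ) :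
    matU p n x * tensor A * matU p n x = tensor A := by
  rw [matU, tensor_mul_tensor, tensor_mul_tensor]
  congr 1
  ext1 i
  split_ifs
  · rw [Matrix.one_mul, Matrix.mul_one]
  · exact matW_mul_mul_matW hp (hA i)

theorem star_vecPhi_dotProduct_matU_mulVec (hp : 0 < p) {x y : Fin n → Fin 2} (hxy : x ≠ y)
    (k l : Fin (2 ^ (p - 1))) :
    star (vecPhi p n k).ofLp ⬝ᵥ (matU p n x * matU p n y).mulVec (vecPhi p n l).ofLp = 0 := by
  obtain ⟨i, hi⟩ := Function.ne_iff.mp hxy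
  rw [matU_mul_matU, star_vecPhi_dotProduct_tensor_mulVec hp]
  · have h : ∀ e, ∏ i, (if x i = y i then 1 else matW p) (blockIndex hp k e)
        (blockIndex hp l e) = (0 : ℂ) := fun e =>
      Finset.prod_eq_zero (Finset.mem_univ i) (by rw [if_neg hi, matW_apply_blockIndex]; simp)
    rw [h, h]
    simp
  · intro j
    split_ifs
    · simp [one_apply_blockIndex]
    · simp [matW_apply_blockIndex]

theorem exp_pow_add_star_exp_pow (hn : 0 < n) {θ : ℝ}
    (hθ : θ = Real.pi / n ∨ θ = -(Real.pi / n)) :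
    Complex.exp (Complex.I * θ / 2) ^ n + star (Complex.exp (Complex.I * θ / 2)) ^ n = 0 := by
  have hn' : (n : ℂ) ≠ 0 := by exact_mod_cast hn.ne'
  have h : Complex.exp (Complex.I * θ / 2) ^ n = Complex.I ∨
      Complex.exp (Complex.I * θ / 2) ^ n = -Complex.I := by
    rw [← Complex.exp_nat_mul]
    rcases hθ with rfl | rfl
    · left
      refine (congrArg Complex.exp ?_).trans Complex.exp_pi_div_two_mul_I
      push_cast
      field_simp
    · right
      refine (congrArg Complex.exp ?_).trans Complex.exp_neg_pi_div_two_mul_I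
      push_cast
      field_simp
  rw [← star_pow]
  rcases h with h | h <;> simp [h]

theorem star_vecPhi_dotProduct_tensor_mulVec_of_mem_spaceL (hp : 0 < p) (hn : 0 < n) {θ : ℝ}
    (hθ : θ = Real.pi / n ∨ θ = -(Real.pi / n))
    {A : Fin n → Matrix (Fin (2 ^ p)) (Fin (2 ^ p)) ℂ} (hA : ∀ i, A i ∈ spaceL p θ)
    (k l : Fin (2 ^ (p - 1))) :
    star (vecPhi p n k).ofLp ⬝ᵥ (tensor A).mulVec (vecPhi p n l).ofLp =
      if k = l then ∏ i, A i 0 0 else 0 := by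
  choose f hf using fun i => exists_of_mem_spaceL (hA i)
  set γ := Complex.exp (Complex.I * θ / 2) with hγ
  have hD : ∀ e, matD p θ (blockIndex hp k e) (blockIndex hp l e) =
      if k = l then 1 else if k < l then (if e = 0 then γ else star γ)
        else (if e = 0 then star γ else γ) := by
    intro e
    have h1 : (2 * (k : ℕ) + e) / 2 = k := by omega
    have h2 : (2 * (l : ℕ) + e) / 2 = l := by omega
    have h3 : (2 * (k : ℕ) + e) % 2 = e := by omega
    have h4 : (2 * (l : ℕ) + e) % 2 = e := by omega
    simp only [matD, Matrix.of_apply, coe_blockIndex, h1, h2, h3, h4, ← hγ, Fin.ext_iff,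
      Fin.lt_def, ne_eq, not_true_eq_false, if_false, Fin.val_zero]
  have hD' : ∀ e e', e ≠ e' → matD p θ (blockIndex hp k e) (blockIndex hp l e') = 1 := by
    intro e e' hee
    have h3 : (2 * (k : ℕ) + e) % 2 = e := by omega
    have h4 : (2 * (l : ℕ) + e') % 2 = e' := by omega
    have h5 : (e : ℕ) ≠ e' := fun h => hee (Fin.ext h)
    simp only [matD, Matrix.of_apply, coe_blockIndex, h3, h4, ne_eq, h5, not_false_eq_true,
      if_true, ite_self]
  have hbit : bit p (blockIndex hp k 1) + bit p (blockIndex hp l 1) =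
      bit p (blockIndex hp k 0) + bit p (blockIndex hp l 0) :=
    bit_add_bit_eq (by simp [coe_blockIndex]; omega) (by simp [coe_blockIndex]; omega)
      (by simp [coe_blockIndex]; omega)
  have hbit' : bit p (blockIndex hp k 0) + bit p (blockIndex hp l 1) =
      bit p (blockIndex hp k 1) + bit p (blockIndex hp l 0) :=
    bit_add_bit_eq (by simp [coe_blockIndex]; omega) (by simp [coe_blockIndex]; omega)
      (by simp [coe_blockIndex])
  rw [star_vecPhi_dotProduct_tensor_mulVec hp]
  · simp only [hf, hD, hbit, Finset.prod_mul_distrib]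
    rcases lt_trichotomy k l with h | h | h
    · simp only [h.ne, h, if_false, if_true, Finset.prod_const, Finset.card_univ,
        Fintype.card_fin, one_ne_zero]
      rw [← add_mul, exp_pow_add_star_exp_pow hn hθ]
      simp
    · subst h
      have h0 : matD p θ 0 0 = 1 := by simp [matD]
      simp only [if_true, bit_add_bit_self, h0, Finset.prod_const_one]
      ring
    · simp only [h.ne', h.not_gt, if_false, if_true, Finset.prod_const, Finset.card_univ,
        Fintype.card_fin, one_ne_zero]
      rw [← add_mul, add_comm, exp_pow_add_star_exp_pow hn hθ]
      simp
  · intro i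
    rw [hf, hf, hD' 0 1 (by simp), hD' 1 0 (by simp), hbit']

/-- The matrix whose columns span `code p n x`. -/
def codeMatrix (p n : ℕ) (x : Fin n → Fin 2) :
    Matrix (Fin n → Fin (2 ^ p)) (Fin (2 ^ (p - 1))) ℂ :=
  Matrix.of fun y k => (matU p n x).mulVec (vecPhi p n k).ofLp y

theorem codeMatrix_conjTranspose_mul_mul_apply (x y : Fin n → Fin 2)
    (C : Matrix (Fin n → Fin (2 ^ p)) (Fin n → Fin (2 ^ p)) ℂ) (k l : Fin (2 ^ (p - 1))) :
    ((codeMatrix p n x).conjTranspose * C * codeMatrix p n y) k l =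
      star (vecPhi p n k).ofLp ⬝ᵥ
        (matU p n x * C * matU p n y).mulVec (vecPhi p n l).ofLp := by
  rw [← Matrix.mulVec_mulVec, ← Matrix.mulVec_mulVec, Matrix.dotProduct_mulVec]
  have h : Matrix.vecMul (star (vecPhi p n k).ofLp) (matU p n x) =
      star ((matU p n x).mulVec (vecPhi p n k).ofLp) := by
    rw [Matrix.star_mulVec, matU_conjTranspose]
  rw [h, Matrix.mul_assoc, Matrix.mul_apply]
  rfl

theorem codeMatrix_conjTranspose_mul_self (hp : 0 < p) (hn : 0 < n) (x : Fin n → Fin 2) :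
    (codeMatrix p n x).conjTranspose * codeMatrix p n x = 1 := by
  ext k l
  have h := codeMatrix_conjTranspose_mul_mul_apply x x 1 k l
  rw [Matrix.mul_one, Matrix.mul_one, matU_mul_self, Matrix.one_mulVec,
    star_vecPhi_dotProduct_vecPhi hp k l hn] at h
  rw [h, Matrix.one_apply]

theorem codeMatrix_conjTranspose_mul_of_ne (hp : 0 < p) {x y : Fin n → Fin 2} (hxy : x ≠ y) :
    (codeMatrix p n x).conjTranspose * codeMatrix p n y = 0 := by
  ext k l
  have h := codeMatrix_conjTranspose_mul_mul_apply x y 1 k l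
  rw [Matrix.mul_one, Matrix.mul_one, star_vecPhi_dotProduct_matU_mulVec hp hxy] at h
  rw [h, Matrix.zero_apply]

theorem inner_toEuclideanLin_matU (x y : Fin n → Fin 2) (k l : Fin (2 ^ (p - 1))) :
    inner ℂ (Matrix.toEuclideanLin (matU p n x) (vecPhi p n k))
        (Matrix.toEuclideanLin (matU p n y) (vecPhi p n l)) =
      ((codeMatrix p n x).conjTranspose * codeMatrix p n y) k l := by
  rw [EuclideanSpace.inner_eq_star_dotProduct, dotProduct_comm, Matrix.mul_apply]
  rfl

theorem finrank_code (hp : 0 < p) (hn : 0 < n) (x : Fin n → Fin 2) :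
    Module.finrank ℂ (code p n x) = 2 ^ (p - 1) := by
  have h : Orthonormal ℂ fun k : Fin (2 ^ (p - 1)) =>
      Matrix.toEuclideanLin (matU p n x) (vecPhi p n k) := by
    rw [orthonormal_iff_ite]
    intro k l
    rw [inner_toEuclideanLin_matU, codeMatrix_conjTranspose_mul_self hp hn, Matrix.one_apply]
  rw [code, finrank_span_eq_card h.linearIndependent, Fintype.card_fin]

theorem isOrtho_code (hp : 0 < p) {x y : Fin n → Fin 2} (hxy : x ≠ y) :
    (code p n x).IsOrtho (code p n y) := by
  rw [code, code, Submodule.isOrtho_span]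
  rintro _ ⟨k, rfl⟩ _ ⟨l, rfl⟩
  rw [inner_toEuclideanLin_matU, codeMatrix_conjTranspose_mul_of_ne hp hxy, Matrix.zero_apply]

theorem codeMatrix_mul_conjTranspose_mulVec (hp : 0 < p) (hn : 0 < n) (x : Fin n → Fin 2)
    (v : EuclideanSpace ℂ (Fin n → Fin (2 ^ p))) (hv : v ∈ code p n x) :
    (codeMatrix p n x * (codeMatrix p n x).conjTranspose).mulVec v.ofLp = v.ofLp := by
  induction hv using Submodule.span_induction with
  | mem v hv =>
    obtain ⟨k, rfl⟩ := hv
    have h : (Matrix.toEuclideanLin (matU p n x) (vecPhi p n k)).ofLp =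
        (codeMatrix p n x).mulVec (Pi.single k 1) := by
      rw [Matrix.mulVec_single_one]
      rfl
    rw [h, Matrix.mulVec_mulVec, Matrix.mul_assoc, codeMatrix_conjTranspose_mul_self hp hn,
      Matrix.mul_one]
  | zero => simp
  | add u v _ _ hu hv => rw [WithLp.ofLp_add, Matrix.mulVec_add, hu, hv]
  | smul c v _ hv => rw [WithLp.ofLp_smul, Matrix.mulVec_smul, hv]

theorem isErrorCorrectingCode_code (hp : 0 < p) (hn : 0 < n) {θ : ℝ}
    (hθ : θ = Real.pi / n ∨ θ = -(Real.pi / n)) {B : Type*} [Fintype B] [DecidableEq B]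
    {Φ : Matrix (Fin (2 ^ p)) (Fin (2 ^ p)) ℂ →ₗ[ℂ] Matrix B B ℂ}
    (hG : noncommutativeGraph Φ = spaceL p θ) (x : Fin n → Fin 2) :
    IsErrorCorrectingCode (tensorPower n Φ) (code p n x) := by
  have h0 : (0 : Matrix (Fin (2 ^ p)) (Fin (2 ^ p)) ℂ) ∈ noncommutativeGraph Φ := by
    rw [hG]
    exact ⟨0, (algL₀ p).zero_mem, Matrix.hadamard_zero _⟩
  obtain ⟨d, V, hV, -⟩ := h0
  rw [tensorPower_eq_krausMap (n := n) (fun _ => krausOf V) fun _ => hV.eq_krausMap]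
  have hmem : ∀ e f, (krausOf V e).conjTranspose * krausOf V f ∈ spaceL p θ := fun e f => by
    rw [← hG]
    exact ⟨d, V, hV, conjTranspose_mul_mem_range_complementaryDual V e f⟩
  refine isErrorCorrectingCode_of_knillLaflamme _ ?_ (codeMatrix p n x)
    (codeMatrix_conjTranspose_mul_self hp hn x)
    (fun e f => ∏ i, ((krausOf V (e i)).conjTranspose * krausOf V (f i)) 0 0) (fun e f => ?_) _
    (codeMatrix_mul_conjTranspose_mulVec hp hn x)
  · simp only [tensor_conjTranspose, tensor_mul_tensor]
    rw [← tensor_sum fun (_ : Fin n) e => (krausOf V e).conjTranspose * krausOf V e]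
    simp only [hV.sum_krausOf, tensor_one]
  · ext k l
    rw [tensor_conjTranspose, tensor_mul_tensor, codeMatrix_conjTranspose_mul_mul_apply,
      matU_mul_tensor_mul_matU hp x fun i => hmem (e i) (f i),
      star_vecPhi_dotProduct_tensor_mulVec_of_mem_spaceL hp hn hθ fun i => hmem (e i) (f i),
      Matrix.smul_apply, Matrix.one_apply, smul_eq_mul, mul_ite, mul_one, mul_zero]

theorem logb_finrank_le_oneShotCapacity {a b : Type*} [Fintype a] [DecidableEq a] [Fintype b]
    {Φ : Matrix a a ℂ →ₗ[ℂ] Matrix b b ℂ} {H₀ : Submodule ℂ (EuclideanSpace ℂ a)}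
    (hne : H₀ ≠ ⊥) (hH : IsErrorCorrectingCode Φ H₀) :
    Real.logb 2 (Module.finrank ℂ H₀) ≤ oneShotCapacity Φ := by
  refine le_csSup ⟨Real.logb 2 (Module.finrank ℂ (EuclideanSpace ℂ a)), ?_⟩ ⟨H₀, hne, hH, rfl⟩
  rintro r ⟨H₁, hne₁, -, rfl⟩
  have h : 0 < Module.finrank ℂ H₁ :=
    Nat.pos_of_ne_zero fun h => hne₁ (Submodule.finrank_eq_zero.mp h)
  exact Real.logb_le_logb_of_le one_lt_two (by exact_mod_cast h)
    (by exact_mod_cast Submodule.finrank_le H₁)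

end Codes

end

end QuantumZeroError

theorem theorem2 (p n : ℕ) (hp : 1 < p) (hn : 1 < n) (θ : ℝ) (hθ : θ ∈ Set.Ioc (-Real.pi) Real.pi)
    {B : Type*} [Fintype B] [DecidableEq B]
    (Φ : Matrix (Fin (2 ^ p)) (Fin (2 ^ p)) ℂ →ₗ[ℂ] Matrix B B ℂ)
    (hΦ : QuantumZeroError.IsChannel Φ)
    (hG : QuantumZeroError.noncommutativeGraph Φ = QuantumZeroError.spaceL p θ) :
    0 < QuantumZeroError.delta p ∧
    (∃ θn : ℝ,
      IsLeast {t : ℝ | 0 < t ∧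
        2 * (1 - Real.cos (t / 2)) + QuantumZeroError.delta p * Real.sin (t / 2)
          = (n : ℝ)⁻¹ * Real.log (3 / 2)} θn ∧
      (|θ| ≤ θn →
        QuantumZeroError.oneShotCapacity (QuantumZeroError.tensorPower n Φ) = 0)) ∧
    ((θ = Real.pi / n ∨ θ = -(Real.pi / n)) →
      (p : ℝ) - 1 ≤ QuantumZeroError.oneShotCapacity (QuantumZeroError.tensorPower n Φ) ∧
      (∀ x : Fin n → Fin 2,
        QuantumZeroError.IsErrorCorrectingCode (QuantumZeroError.tensorPower n Φ)
            (QuantumZeroError.code p n x) ∧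
          Module.finrank ℂ (QuantumZeroError.code p n x) = 2 ^ (p - 1)) ∧
      (∀ x y : Fin n → Fin 2, x ≠ y →
        (QuantumZeroError.code p n x).IsOrtho (QuantumZeroError.code p n y))) := by

  have hp0 : 0 < p := by omega
  have hn0 : 0 < n := by omega
  have hδ := QuantumZeroError.delta_pos p hp
  refine ⟨hδ, ?_, fun hθn => ⟨?_, fun x =>
    ⟨QuantumZeroError.isErrorCorrectingCode_code hp0 hn0 hθn hG x,
      QuantumZeroError.finrank_code hp0 hn0 x⟩,
    fun x y hxy => QuantumZeroError.isOrtho_code hp0 hxy⟩⟩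
  · have hlog : 0 < Real.log (3 / 2) := Real.log_pos (by norm_num)
    have hlog2 : Real.log (3 / 2) ≤ 3 / 2 - 1 := Real.log_le_sub_one_of_pos (by norm_num)
    have hn1 : (1 : ℝ) ≤ n := by exact_mod_cast hn0
    have hinv : (n : ℝ)⁻¹ ≤ 1 := inv_le_one_of_one_le₀ hn1
    obtain ⟨t₀, hleast, hle⟩ := QuantumZeroError.exists_isLeast_threshold hδ
      (L := (n : ℝ)⁻¹ * Real.log (3 / 2)) (by positivity) (by nlinarith)
    refine ⟨t₀, hleast, fun hθt => ?_⟩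
    have hbound : QuantumZeroError.deformationBound p θ =
        2 * (1 - Real.cos (|θ| / 2)) + QuantumZeroError.delta p * Real.sin (|θ| / 2) := by
      have habs : |θ| ≤ Real.pi := abs_le.mpr ⟨hθ.1.le, hθ.2⟩
      have h1 : |θ / 2| = |θ| / 2 := by rw [abs_div, abs_two]
      rw [QuantumZeroError.deformationBound, ← Real.cos_abs (θ / 2), h1,
        Real.abs_sin_eq_sin_abs_of_abs_le_pi (by rw [h1]; linarith [abs_nonneg θ]), h1]
    have hnonneg : 0 ≤ QuantumZeroError.deformationBound p θ :=
      add_nonneg (mul_nonneg two_pos.le (sub_nonneg.mpr (Real.cos_le_one _)))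
        (mul_nonneg hδ.le (abs_nonneg _))
    exact QuantumZeroError.oneShotCapacity_eq_zero hp0 hG
      (QuantumZeroError.one_add_pow_sub_one_lt hn0 hnonneg
        (hbound ▸ hle |θ| (abs_nonneg θ) hθt))
  · have hrank := QuantumZeroError.finrank_code hp0 hn0 (0 : Fin n → Fin 2)
    have hne : QuantumZeroError.code p n 0 ≠ ⊥ := by
      intro h
      rw [h, finrank_bot] at hrank
      exact (pow_pos two_pos (p - 1)).ne hrank
    have h := QuantumZeroError.logb_finrank_le_oneShotCapacity hne
      (QuantumZeroError.isErrorCorrectingCode_code hp0 hn0 hθn hG 0)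
    rw [hrank] at h
    push_cast [Nat.cast_sub hp0] at h
    rw [Real.logb_pow, Real.logb_self_eq_one one_lt_two, mul_one, Nat.cast_sub hp0,
      Nat.cast_one] at h
    exact h
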